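/- **Theorem 1** (Fractal dimension of the von Koch snowflake). For $s\in(0,1)$ and $E\subset\mathbb R^n$ measurable let $$P_s(E)=\int_E\int_{\mathbb R^n\setminus E}\frac{dx\,dy}{|x-y|^{n+s}}\in[0,\infty]$$ be the $s$-fractional perimeter of $E$, let $$\partial^-E=\{x\in\mathbb R^n : 0<|E\cap B_r(x)|<|B_r(x)|\ \text{for every } r>0\}$$ be its measure theoretic boundary, and, if $\partial^-E\neq\emptyset$, let $$\operatorname{Dim}_F(\partial^-E)=n-\sup\{s\in(0,1) : P_s(E)<\infty\}$$ (with $\sup\emptyset=0$). For $\Gamma\subset\mathbb R^n$ and $\rho>0$ put $\bar N_\rho(\Gamma)=\{x : d(x,\Gamma)\le\rho\}$; the lower and upper Minkowski dimensions of $\Gamma$ are $$\underline{\operatorname{Dim}}_{\mathcal M}(\Gamma)=\inf\Big\{r\in[0,n] : \liminf_{\rho\to0^+}\frac{|\bar N_\rho(\Gamma)|}{\rho^{n-r}}=0\Big\},\qquad \overline{\operatorname{Dim}}_{\mathcal M}(\Gamma)=\sup\Big\{r\in[0,n] : \limsup_{\rho\to0^+}\frac{|\bar N_\rho(\Gamma)|}{\rho^{n-r}}=\infty\Big\}$$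 (the infimum of the empty set being read as $n$, the supremum as $0$), and $\operatorname{Dim}_{\mathcal M}(\Gamma)$ is their common value if they agree. Let $\Sigma_0\subset\mathbb R^2$ be an equilateral triangle (as a closed curve) with sides of length $1$; let $\Sigma_{k+1}$ arise from $\Sigma_k$ by replacing the middle third of each side by the other two sides of the equilateral triangle erected outward on it; let $\Sigma$ be the limit of the polygonal curves $\Sigma_k$ as $k\to\infty$. The von Koch snowflake $S\subset\mathbb R^2$ is the bounded region enclosed by $\Sigma$. Then $$P_s(S)<\infty\quad\text{for all } s\in\Big(0,\,2-\frac{\log4}{\log3}\Big),\qquad P_s(S)=\infty\quad\text{for all } s\in\Big[2-\frac{\log4}{\log3},\,1\Big).$$ Moreover $\partial^-S=\partial S$, and $$\operatorname{Dim}_F(\partial S)=\operatorname{Dim}_{\mathcal M}(\partial S)=\frac{\log4}{\log3}.$$ In particular the Minkowski dimension of $\partial S$ exists, that is, its lower and upper Minkowski dimensions agree. -/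

import Mathlib

open MeasureTheory Set Filter Topology

noncomputable section

namespace KochSnowflake

/-! ### Fractional perimeter -/

/-- The interaction `L_s(A, B) = ∫_A ∫_B |x - y|^{-(n+s)} dx dy`, with values in `[0, ∞]`. -/
def interaction {n : ℕ} (s : ℝ) (A B : Set (EuclideanSpace ℝ (Fin n))) : ENNReal :=
  ∫⁻ x in A, ∫⁻ y in B, ENNReal.ofReal (1 / ‖x - y‖ ^ ((n : ℝ) + s))

/-- The local part `P_s^L(E, Ω)` of the fractional perimeter of `E` in `Ω`. -/
def localFracPerimeter {n : ℕ} (s : ℝ) (E Ω : Set (EuclideanSpace ℝ (Fin n))) : ENNReal :=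
  interaction s (E ∩ Ω) (Eᶜ ∩ Ω)

/-- The `s`-fractional perimeter `P_s(E, Ω)` of `E` in `Ω`. -/
def fracPerimeterIn {n : ℕ} (s : ℝ) (E Ω : Set (EuclideanSpace ℝ (Fin n))) : ENNReal :=
  interaction s (E ∩ Ω) (Eᶜ ∩ Ω) + interaction s (E ∩ Ω) (Eᶜ \ Ω) +
    interaction s (E \ Ω) (Eᶜ ∩ Ω)

/-- The `s`-fractional perimeter `P_s(E) = P_s(E, ℝⁿ)`. -/
def fracPerimeter {n : ℕ} (s : ℝ) (E : Set (EuclideanSpace ℝ (Fin n))) : ENNReal :=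
  fracPerimeterIn s E univ

/-! ### Dimensions -/

/-- The measure theoretic boundary `∂⁻E`: the points all of whose balls meet both `E` and its
complement in positive measure. -/
def measureBoundary {n : ℕ} (E : Set (EuclideanSpace ℝ (Fin n))) :
    Set (EuclideanSpace ℝ (Fin n)) :=
  {x | ∀ r : ℝ, 0 < r →
    0 < volume (E ∩ Metric.ball x r) ∧ volume (E ∩ Metric.ball x r) < volume (Metric.ball x r)}

/-- The fractal dimension `Dim_F(∂⁻E, Ω)` of the measure theoretic boundary of `E` in `Ω`,
relative to the fractional perimeter. The supremum of the empty set is `0`. -/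
def fracDim {n : ℕ} (E Ω : Set (EuclideanSpace ℝ (Fin n))) : ℝ :=
  (n : ℝ) - sSup {s : ℝ | s ∈ Ioo (0 : ℝ) 1 ∧ localFracPerimeter s E Ω < ⊤}

/-- The lower `r`-dimensional Minkowski content of `G` relative to `Ω`. -/
def lowerMinkowskiContent {n : ℕ} (r : ℝ) (G Ω : Set (EuclideanSpace ℝ (Fin n))) : ENNReal :=
  liminf (fun ρ : ℝ => volume (Metric.cthickening ρ G ∩ Ω) / ENNReal.ofReal (ρ ^ ((n : ℝ) - r)))
    (𝓝[>] (0 : ℝ))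

/-- The upper `r`-dimensional Minkowski content of `G` relative to `Ω`. -/
def upperMinkowskiContent {n : ℕ} (r : ℝ) (G Ω : Set (EuclideanSpace ℝ (Fin n))) : ENNReal :=
  limsup (fun ρ : ℝ => volume (Metric.cthickening ρ G ∩ Ω) / ENNReal.ofReal (ρ ^ ((n : ℝ) - r)))
    (𝓝[>] (0 : ℝ))

/-- The lower Minkowski dimension, `n - sup {r ∈ [0, n] | lower (n - r)-content = 0}`; this is
`inf {r ∈ [0, n] | lower r-content = 0}`, with the value `n` if there is no such `r`. -/
def lowerMinkowskiDim {n : ℕ} (G Ω : Set (EuclideanSpace ℝ (Fin n))) : ℝ :=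
  (n : ℝ) - sSup {r : ℝ | r ∈ Icc (0 : ℝ) (n : ℝ) ∧ lowerMinkowskiContent ((n : ℝ) - r) G Ω = 0}

/-- The upper Minkowski dimension, `sup {r ∈ [0, n] | upper r-content = ∞}`, with the value `0`
if there is no such `r`. -/
def upperMinkowskiDim {n : ℕ} (G Ω : Set (EuclideanSpace ℝ (Fin n))) : ℝ :=
  sSup {r : ℝ | r ∈ Icc (0 : ℝ) (n : ℝ) ∧ upperMinkowskiContent r G Ω = ⊤}

/-! ### The von Koch snowflake -/

/-- Clockwise rotation of the plane by the angle `π / 3`. -/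
def rotateClockwise (v : EuclideanSpace ℝ (Fin 2)) : EuclideanSpace ℝ (Fin 2) :=
  !₂[v 0 / 2 + Real.sqrt 3 / 2 * v 1, -(Real.sqrt 3 / 2) * v 0 + v 1 / 2]

/-- The four oriented segments that replace the oriented segment from `e.1` to `e.2`: its middle
third is exchanged for the other two sides of the equilateral triangle that is erected on it, to
the right of the direction of travel. -/
def subdivide (e : EuclideanSpace ℝ (Fin 2) × EuclideanSpace ℝ (Fin 2)) :
    List (EuclideanSpace ℝ (Fin 2) × EuclideanSpace ℝ (Fin 2)) :=
  let d := (1 / 3 : ℝ) • (e.2 - e.1)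
  [(e.1, e.1 + d),
   (e.1 + d, e.1 + d + rotateClockwise d),
   (e.1 + d + rotateClockwise d, e.1 + (2 : ℝ) • d),
   (e.1 + (2 : ℝ) • d, e.2)]

/-- The oriented sides of the `k`-th polygon. The start is the equilateral triangle of side `1`
with barycentre at the origin and a vertex on the positive `y`-axis, run through anticlockwise, so
that the exterior lies to the right. -/
def polygonSides : ℕ → List (EuclideanSpace ℝ (Fin 2) × EuclideanSpace ℝ (Fin 2))
  | 0 =>
    [(!₂[0, Real.sqrt 3 / 3], !₂[-(1 / 2), -(Real.sqrt 3 / 6)]),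
     (!₂[-(1 / 2), -(Real.sqrt 3 / 6)], !₂[1 / 2, -(Real.sqrt 3 / 6)]),
     (!₂[1 / 2, -(Real.sqrt 3 / 6)], !₂[0, Real.sqrt 3 / 3])]
  | k + 1 => (polygonSides k).flatMap subdivide

/-- The `k`-th closed polygonal curve of the construction, as a subset of the plane. -/
def polygonCurve (k : ℕ) : Set (EuclideanSpace ℝ (Fin 2)) :=
  ⋃ e ∈ polygonSides k, segment ℝ e.1 e.2

/-- The limit of the polygonal curves: the points whose distance to the `k`-th curve tends
to `0`. -/
def kochCurve : Set (EuclideanSpace ℝ (Fin 2)) :=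
  {x | Tendsto (fun k : ℕ => Metric.infDist x (polygonCurve k)) atTop (𝓝 0)}

/-- The von Koch snowflake: the bounded region that the limit curve encloses, that is, the points
off the curve whose connected component in the complement of the curve is bounded. -/
def snowflake : Set (EuclideanSpace ℝ (Fin 2)) :=
  {x | x ∈ kochCurveᶜ ∧ Bornology.IsBounded (connectedComponentIn kochCurveᶜ x)}

end KochSnowflake

end

/-!
# The fractal dimension of the von Koch snowflake

Let `K` be the limit curve, `S` the snowflake, and `δ = 2 - log 4 / log 3`, so that
`(1 / 3) ^ δ = 4 / 9`. Everything rests on two facts about the `3 * 4 ^ k` sides of the `k`-th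
polygon, which have length `3⁻ᵏ`.

* *Covering.* `K` is contained in `3 * 4 ^ k` discs of radius comparable to `3⁻ᵏ`, so the
  `3⁻ᵏ`-neighbourhood of `K` has area at most `C (4 / 9) ^ k` (`volume_cthickening_kochCurve_le`).
* *Two-sided balls.* For each side of the `k`-th polygon there is a ball `insideBall ⊆ S` and a ball
  `outsideBall ⊆ Sᶜ`, of radius comparable to `3⁻ᵏ` and at distance at most `3⁻ᵏ`. The inside balls
  are pairwise disjoint, also across different `k`.

The first fact bounds the Minkowski content from above, and it makes the fractional perimeter finite
for `s < δ`, by decomposing the pairs `(x, y) ∈ S × Sᶜ` dyadically according to their distance: such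
a pair at distance at most `3⁻ʲ` has `x` in the `3⁻ʲ`-neighbourhood of `K`. The second bounds the
content from below, shows that `∂⁻S = ∂S`, and gives infinite fractional perimeter for `s ≥ δ`,
because every generation then contributes at least a fixed positive amount.

The geometric work is to decide, without the Jordan curve theorem, which points `K` encloses. In
the oblique frame `chart e` of a side `e` all vertices are rational and all inclusions become
linear inequalities. The Koch arc over `e` lies in an isosceles triangle `hull e` with base angles
`π / 6`, and `K` is the decreasing intersection of the unions `arcs k` of these triangles
(`kochCurve_eq_iInter_arcs`). The hulls of one generation meet only in end points of the sides
(`pairwise_polygonSides`), and meet the filled polygon `solid k` only in the sides.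

* The union `inside` of the interiors of `solid k` is open and bounded, misses `K`, and is
  relatively closed in `Kᶜ`, since `frontier (solid k)` lies on the `k`-th polygon. So it is a
  union of bounded components of `Kᶜ` (`inside_subset_snowflake`).
* A point outside `solid k ∪ arcs k` can be joined to infinity in `Kᶜ`, by induction on `k`
  (`escapes_of_notMem_outer`): the only new exterior points of a generation lie in one of two gaps
  of some `hull e`, and each gap is bordered by a piece of the outer edge of the hull, which can be
  crossed into the exterior of the previous generation.
-/

namespace KochSnowflake

/-! ### Oblique coordinates attached to an oriented segment -/

/-- The Euclidean plane. -/
abbrev Plane := EuclideanSpace ℝ (Fin 2)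

/-- The point with coordinates `p` in the oblique affine frame of the oriented segment `e`: its
origin is `e.1`, its axes are the direction `d` of `e` and `d` turned clockwise by `π / 3`. In
these coordinates all vertices of the Koch construction are rational, and the outer side of `e` is
`0 < p.2`. -/
noncomputable def chart (e : Plane × Plane) (p : ℝ × ℝ) : Plane :=
  e.1 + p.1 • (e.2 - e.1) + p.2 • rotateClockwise (e.2 - e.1)

lemma rotateClockwise_add (v w : Plane) :
    rotateClockwise (v + w) = rotateClockwise v + rotateClockwise w := by
  ext i; fin_cases i <;> simp [rotateClockwise] <;> ring

lemma rotateClockwise_smul (c : ℝ) (v : Plane) :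
    rotateClockwise (c • v) = c • rotateClockwise v := by
  ext i; fin_cases i <;> simp [rotateClockwise] <;> ring

lemma rotateClockwise_rotateClockwise (v : Plane) :
    rotateClockwise (rotateClockwise v) = rotateClockwise v - v := by
  have h : Real.sqrt 3 * Real.sqrt 3 = 3 := Real.mul_self_sqrt (by norm_num)
  ext i
  fin_cases i <;> simp [rotateClockwise]
  · linear_combination (-(1 / 4) * v 0) * h
  · linear_combination (-(1 / 4) * v 1) * h

lemma norm_smul_add_smul_rotateClockwise_sq (v : Plane) (a b : ℝ) :
    ‖a • v + b • rotateClockwise v‖ ^ 2 = (a ^ 2 + a * b + b ^ 2) * ‖v‖ ^ 2 := by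
  have h : Real.sqrt 3 * Real.sqrt 3 = 3 := Real.mul_self_sqrt (by norm_num)
  simp only [EuclideanSpace.real_norm_sq_eq, Fin.sum_univ_two]
  simp [rotateClockwise]
  linear_combination (b ^ 2 / 4 * (v 0 ^ 2 + v 1 ^ 2)) * h

lemma norm_chart_sub_sq (e : Plane × Plane) (p q : ℝ × ℝ) :
    ‖chart e p - chart e q‖ ^ 2 =
      ((p.1 - q.1) ^ 2 + (p.1 - q.1) * (p.2 - q.2) + (p.2 - q.2) ^ 2) * ‖e.2 - e.1‖ ^ 2 := by
  rw [← norm_smul_add_smul_rotateClockwise_sq]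
  congr 2
  simp only [chart]
  module

lemma chart_zero (e : Plane × Plane) : chart e (0, 0) = e.1 := by simp [chart]

lemma chart_one (e : Plane × Plane) : chart e (1, 0) = e.2 := by simp [chart]

lemma chart_injective {e : Plane × Plane} (he : 0 < ‖e.2 - e.1‖) :
    Function.Injective (chart e) := by
  intro p q h
  have h1 := norm_chart_sub_sq e p q
  rw [h, sub_self, norm_zero, zero_pow two_ne_zero, eq_comm,
    mul_eq_zero_iff_right (by positivity)] at h1
  have h2 : p.1 - q.1 = 0 := by nlinarith [sq_nonneg (p.1 - q.1 + 2 * (p.2 - q.2))]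
  have h3 : p.2 - q.2 = 0 := by nlinarith [sq_nonneg (2 * (p.1 - q.1) + (p.2 - q.2))]
  exact Prod.ext (by linarith) (by linarith)

/-- The linear part of `chart`. -/
noncomputable def chartLinear (v : Plane) : ℝ × ℝ →ₗ[ℝ] Plane :=
  (LinearMap.fst ℝ ℝ ℝ).smulRight v + (LinearMap.snd ℝ ℝ ℝ).smulRight (rotateClockwise v)

lemma chart_eq (e : Plane × Plane) : chart e = fun p => e.1 + chartLinear (e.2 - e.1) p := by
  ext1 p
  simp [chart, chartLinear, add_assoc]

lemma chartLinear_surjective {e : Plane × Plane} (he : 0 < ‖e.2 - e.1‖) :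
    Function.Surjective (chartLinear (e.2 - e.1)) := by
  rw [← LinearMap.injective_iff_surjective_of_finrank_eq_finrank (by simp)]
  intro p q h
  apply chart_injective he
  simp [chart_eq, h]

lemma chart_surjective {e : Plane × Plane} (he : 0 < ‖e.2 - e.1‖) :
    Function.Surjective (chart e) := by
  intro x
  obtain ⟨p, hp⟩ := chartLinear_surjective he (x - e.1)
  exact ⟨p, by simp [chart_eq, hp]⟩

lemma continuous_chart (e : Plane × Plane) : Continuous (chart e) := by
  unfold chart; fun_prop

lemma isOpenMap_chart {e : Plane × Plane} (he : 0 < ‖e.2 - e.1‖) : IsOpenMap (chart e) := by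
  rw [chart_eq]
  have h := (LinearMap.toContinuousLinearMap (chartLinear (e.2 - e.1))).isOpenMap
    (chartLinear_surjective he)
  exact (Homeomorph.addLeft e.1).isOpenMap.comp h

lemma chart_combo (e : Plane × Plane) (p q : ℝ × ℝ) {a b : ℝ} (hab : a + b = 1) :
    a • chart e p + b • chart e q = chart e (a • p + b • q) := by
  obtain rfl : b = 1 - a := by linarith
  simp only [chart, Prod.fst_add, Prod.snd_add, Prod.smul_fst, Prod.smul_snd, smul_eq_mul]
  module

lemma convex_chart_image (e : Plane × Plane) {A : Set (ℝ × ℝ)} (hA : Convex ℝ A) :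
    Convex ℝ (chart e '' A) := by
  rintro _ ⟨p, hp, rfl⟩ _ ⟨q, hq, rfl⟩ a b ha hb hab
  rw [chart_combo e p q hab]
  exact ⟨_, hA hp hq ha hb hab, rfl⟩

/-- A point close to `chart e p` has coordinates close to `p`. -/
lemma exists_chart_eq_of_mem_ball {e : Plane × Plane} (he : 0 < ‖e.2 - e.1‖) {p : ℝ × ℝ}
    {r : ℝ} (hr : 0 < r) {x : Plane} (hx : x ∈ Metric.ball (chart e p) (r * ‖e.2 - e.1‖)) :
    ∃ q, chart e q = x ∧ |q.1 - p.1| < 2 * r ∧ |q.2 - p.2| < 2 * r := by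
  obtain ⟨q, rfl⟩ := chart_surjective he x
  refine ⟨q, rfl, ?_⟩
  rw [mem_ball_iff_norm] at hx
  have h1 := norm_chart_sub_sq e q p
  have h2 : ‖chart e q - chart e p‖ ^ 2 < (r * ‖e.2 - e.1‖) ^ 2 := by
    gcongr
  rw [h1, mul_pow] at h2
  have h3 := lt_of_mul_lt_mul_right h2 (by positivity)
  constructor <;> apply abs_lt_of_sq_lt_sq _ (by positivity)
  · nlinarith [sq_nonneg (q.1 - p.1 + 2 * (q.2 - p.2)), sq_nonneg r, sq_pos_of_pos hr]
  · nlinarith [sq_nonneg (2 * (q.1 - p.1) + (q.2 - p.2)), sq_nonneg r, sq_pos_of_pos hr]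

/-! ### The pieces of the construction over one segment -/

/-- In coordinates, the isosceles triangle with base `[(0, 0), (1, 0)]` and base angles `π / 6` on
the outer side: the convex hull of the Koch arc over the base. -/
def hullRef : Set (ℝ × ℝ) := {p | 0 ≤ p.2 ∧ p.2 ≤ p.1 ∧ p.1 + 2 * p.2 ≤ 1}

/-- In coordinates, the equilateral triangle erected outward on the middle third. -/
def bumpRef : Set (ℝ × ℝ) := {p | 0 ≤ p.2 ∧ 1 / 3 ≤ p.1 ∧ p.1 + p.2 ≤ 2 / 3}

/-- In coordinates, the equilateral triangle erected inward on the whole segment. -/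
def innerRef : Set (ℝ × ℝ) := {p | p.2 ≤ 0 ∧ p.1 ≤ 1 ∧ 0 ≤ p.1 + p.2}

/-- The points of the left gap between the bump, the hulls of the new segments and the outer edge
of the hull, in coordinates. -/
def leftGapRef : Set (ℝ × ℝ) := {p | p.2 ≤ p.1 ∧ 1 / 3 < p.1 + 2 * p.2 ∧ 2 * p.1 + p.2 < 2 / 3}

/-- The mirror image of `leftGapRef`. -/
def rightGapRef : Set (ℝ × ℝ) :=
  {p | p.1 + 2 * p.2 ≤ 1 ∧ p.1 - p.2 < 2 / 3 ∧ 4 / 3 < 2 * p.1 + p.2}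

/-- The hull of the Koch arc over `e`. -/
def hull (e : Plane × Plane) : Set Plane := chart e '' hullRef

/-- The triangle erected outward on the middle third of `e`. -/
def bump (e : Plane × Plane) : Set Plane := chart e '' bumpRef

/-- The equilateral triangle erected inward on `e`. -/
def inner (e : Plane × Plane) : Set Plane := chart e '' innerRef

lemma segment_eq_chart_image (e : Plane × Plane) :
    segment ℝ e.1 e.2 = (fun t : ℝ => chart e (t, 0)) '' Icc (0 : ℝ) 1 := by
  rw [segment_eq_image']
  simp [chart]

/-- The segment whose end points are the images of `(0, 0)` and `(1, 0)` under the coordinate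
change `ψ`. -/
noncomputable def subEdge (e : Plane × Plane) (ψ : ℝ × ℝ → ℝ × ℝ) : Plane × Plane :=
  (chart e (ψ (0, 0)), chart e (ψ (1, 0)))

/-- The changes of coordinates from the frames of the four new segments to that of the old one. -/
noncomputable def childMaps : List (ℝ × ℝ → ℝ × ℝ) :=
  [fun p => (p.1 / 3, p.2 / 3),
   fun p => (1 / 3 - p.2 / 3, p.1 / 3 + p.2 / 3),
   fun p => (1 / 3 + p.1 / 3 + p.2 / 3, 1 / 3 - p.1 / 3),
   fun p => (2 / 3 + p.1 / 3, p.2 / 3)]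

/-- The change of coordinates from the frame of the second side of the initial triangle to that of
the first side. -/
def turn (p : ℝ × ℝ) : ℝ × ℝ := (1 + p.2, -p.1 - p.2)

lemma rotateClockwise_combo (v : Plane) (a b : ℝ) :
    rotateClockwise (a • v + b • rotateClockwise v) =
      (-b) • v + (a + b) • rotateClockwise v := by
  rw [rotateClockwise_add, rotateClockwise_smul, rotateClockwise_smul,
    rotateClockwise_rotateClockwise]
  module

/-- The coordinate change `ψ` is an orientation preserving similarity. With `ω` the clockwise turn
by `π / 3`, so that `ω ^ 2 = ω - 1`, it is `u + v ω ↦ (c + d ω) + (u + v ω) (a + b ω)`. -/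
def IsFrameChange (ψ : ℝ × ℝ → ℝ × ℝ) : Prop :=
  ∃ a b c d : ℝ, ∀ p, ψ p = (c + p.1 * a - p.2 * b, d + p.1 * b + p.2 * (a + b))

lemma IsFrameChange.chart_subEdge {ψ : ℝ × ℝ → ℝ × ℝ} (hψ : IsFrameChange ψ) (e : Plane × Plane)
    (p : ℝ × ℝ) : chart (subEdge e ψ) p = chart e (ψ p) := by
  obtain ⟨a, b, c, d, h⟩ := hψ
  have h2 : (subEdge e ψ).2 - (subEdge e ψ).1 =
      a • (e.2 - e.1) + b • rotateClockwise (e.2 - e.1) := by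
    simp only [subEdge, h, chart]
    module
  rw [chart, h2, rotateClockwise_combo, h]
  simp only [subEdge, h, chart]
  module

lemma isFrameChange_of_mem_childMaps {ψ : ℝ × ℝ → ℝ × ℝ} (h : ψ ∈ childMaps) :
    IsFrameChange ψ := by
  simp only [childMaps, List.mem_cons, List.not_mem_nil, or_false] at h
  rcases h with rfl | rfl | rfl | rfl
  · exact ⟨1 / 3, 0, 0, 0, fun p => by ext <;> simp <;> ring⟩
  · exact ⟨0, 1 / 3, 1 / 3, 0, fun p => by ext <;> simp <;> ring⟩
  · exact ⟨1 / 3, -1 / 3, 1 / 3, 1 / 3, fun p => by ext <;> simp <;> ring⟩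
  · exact ⟨1 / 3, 0, 2 / 3, 0, fun p => by ext <;> simp <;> ring⟩

lemma isFrameChange_turn : IsFrameChange turn :=
  ⟨0, -1, 1, 0, fun p => by ext <;> (simp [turn]; try ring)⟩

lemma isFrameChange_turn_turn : IsFrameChange (turn ∘ turn) :=
  ⟨-1, 1, 1, -1, fun p => by ext <;> simp [turn] <;> ring⟩

lemma subdivide_eq (e : Plane × Plane) : subdivide e = childMaps.map (subEdge e) := by
  simp only [subdivide, childMaps, List.map_cons, List.map_nil, subEdge, chart,
    rotateClockwise_smul]
  refine congrArg₂ _ (Prod.ext ?_ ?_) (congrArg₂ _ (Prod.ext ?_ ?_)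
    (congrArg₂ _ (Prod.ext ?_ ?_) (congrArg₂ _ (Prod.ext ?_ ?_) rfl))) <;> · simp only []; module

/-- The first side of the initial triangle. -/
noncomputable def rootEdge : Plane × Plane :=
  (!₂[0, Real.sqrt 3 / 3], !₂[-(1 / 2), -(Real.sqrt 3 / 6)])

lemma polygonSides_zero :
    polygonSides 0 = [subEdge rootEdge id, subEdge rootEdge turn,
      subEdge rootEdge (turn ∘ turn)] := by
  have h : Real.sqrt 3 * Real.sqrt 3 = 3 := Real.mul_self_sqrt (by norm_num)
  have hA : chart rootEdge (0, 0) = !₂[0, Real.sqrt 3 / 3] := chart_zero _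
  have hB : chart rootEdge (1, 0) = !₂[-(1 / 2), -(Real.sqrt 3 / 6)] := chart_one _
  have hC : chart rootEdge (1, -1) = !₂[1 / 2, -(Real.sqrt 3 / 6)] := by
    ext i; fin_cases i <;> simp [chart, rootEdge, rotateClockwise] <;> linarith
  simp [polygonSides, subEdge, turn, hA, hB, hC]

lemma isFrameChange_id : IsFrameChange id := ⟨1, 0, 0, 0, fun p => by ext <;> simp⟩

/-! ### The pieces over the sides of the polygons -/

lemma mem_subdivide {e c : Plane × Plane} :
    c ∈ subdivide e ↔ ∃ ψ ∈ childMaps, subEdge e ψ = c := by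
  rw [subdivide_eq, List.mem_map]

lemma mem_polygonSides_succ {k : ℕ} {c : Plane × Plane} :
    c ∈ polygonSides (k + 1) ↔ ∃ e ∈ polygonSides k, c ∈ subdivide e := by
  rw [polygonSides, List.mem_flatMap]

lemma chart_subEdge_of_mem {ψ : ℝ × ℝ → ℝ × ℝ} (h : ψ ∈ childMaps) (e : Plane × Plane)
    (p : ℝ × ℝ) : chart (subEdge e ψ) p = chart e (ψ p) :=
  (isFrameChange_of_mem_childMaps h).chart_subEdge e p

lemma forall_mem_childMaps {P : (ℝ × ℝ → ℝ × ℝ) → Prop} :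
    (∀ ψ ∈ childMaps, P ψ) ↔ P (fun p => (p.1 / 3, p.2 / 3)) ∧
      P (fun p => (1 / 3 - p.2 / 3, p.1 / 3 + p.2 / 3)) ∧
      P (fun p => (1 / 3 + p.1 / 3 + p.2 / 3, 1 / 3 - p.1 / 3)) ∧
      P (fun p => (2 / 3 + p.1 / 3, p.2 / 3)) := by
  simp [childMaps]

lemma norm_subdivide {e c : Plane × Plane} (h : c ∈ subdivide e) :
    ‖c.2 - c.1‖ = ‖e.2 - e.1‖ / 3 := by
  obtain ⟨ψ, hψ, rfl⟩ := mem_subdivide.1 h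
  rw [← sq_eq_sq₀ (norm_nonneg _) (by positivity)]
  simp only [subEdge]
  rw [norm_chart_sub_sq, div_pow, div_eq_inv_mul]
  congr 1
  revert ψ
  rw [forall_mem_childMaps]
  norm_num

lemma norm_polygonSides_zero {e : Plane × Plane} (h : e ∈ polygonSides 0) :
    ‖e.2 - e.1‖ = 1 := by
  have hs : Real.sqrt 3 * Real.sqrt 3 = 3 := Real.mul_self_sqrt (by norm_num)
  rw [← sq_eq_sq₀ (norm_nonneg _) (by positivity), EuclideanSpace.real_norm_sq_eq]
  simp only [polygonSides, List.mem_cons, List.not_mem_nil, or_false] at h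
  rcases h with rfl | rfl | rfl <;> simp [Fin.sum_univ_two]
  · linear_combination (1 / 4) * hs
  · norm_num
  · linear_combination (1 / 4) * hs

lemma norm_polygonSides {k : ℕ} {e : Plane × Plane} (h : e ∈ polygonSides k) :
    ‖e.2 - e.1‖ = (1 / 3) ^ k := by
  induction k generalizing e with
  | zero => simpa using norm_polygonSides_zero h
  | succ k ih =>
    obtain ⟨e', he', hc⟩ := mem_polygonSides_succ.1 h
    rw [norm_subdivide hc, ih he', pow_succ]
    ring

lemma norm_polygonSides_pos {k : ℕ} {e : Plane × Plane} (h : e ∈ polygonSides k) :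
    0 < ‖e.2 - e.1‖ := by
  rw [norm_polygonSides h]; positivity

lemma length_polygonSides (k : ℕ) : (polygonSides k).length = 3 * 4 ^ k := by
  induction k with
  | zero => simp [polygonSides]
  | succ k ih =>
    have h : ∀ e : Plane × Plane, (subdivide e).length = 4 := fun e => by simp [subdivide]
    simp only [polygonSides, List.length_flatMap, h, List.map_const', List.sum_replicate, ih]
    simp; ring

lemma polygonSides_ne_nil (k : ℕ) : polygonSides k ≠ [] := by
  rw [← List.length_pos_iff_ne_nil, length_polygonSides]; positivity

/-! ### Bookkeeping in coordinates -/

lemma mem_hullRef_of_mem_childMaps {ψ : ℝ × ℝ → ℝ × ℝ} (hψ : ψ ∈ childMaps) {p : ℝ × ℝ}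
    (hp : p ∈ hullRef) : ψ p ∈ hullRef := by
  obtain ⟨h1, h2, h3⟩ := hp
  revert ψ
  rw [forall_mem_childMaps]
  simp only [hullRef, mem_ofPred_eq]
  refine ⟨⟨?_, ?_, ?_⟩, ⟨?_, ?_, ?_⟩, ⟨?_, ?_, ?_⟩, ?_, ?_, ?_⟩ <;> linarith

lemma bumpRef_subset_hullRef : bumpRef ⊆ hullRef := by
  rintro p ⟨h1, h2, h3⟩
  refine ⟨?_, ?_, ?_⟩ <;> linarith

/-- `p` is one of the two end points of the base, in coordinates. -/
def IsEnd (p : ℝ × ℝ) : Prop := p = (0, 0) ∨ p = (1, 0)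

lemma isEnd_of_isEnd_childMaps {ψ : ℝ × ℝ → ℝ × ℝ} (hψ : ψ ∈ childMaps) {p : ℝ × ℝ}
    (hp : p ∈ hullRef) (h : IsEnd (ψ p)) : IsEnd p := by
  obtain ⟨h1, h2, h3⟩ := hp
  revert ψ
  rw [forall_mem_childMaps]
  simp only [IsEnd, Prod.ext_iff]
  refine ⟨?_, ?_, ?_, ?_⟩ <;> (rintro (⟨h4, h5⟩ | ⟨h4, h5⟩)) <;>
    first
    | (exfalso; linarith)
    | (left; constructor <;> linarith)
    | (right; constructor <;> linarith)

/-- The hulls of two of the four new segments meet at most in a common end point. -/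
lemma pairwise_childMaps :
    childMaps.Pairwise fun ψ ψ' => ∀ p ∈ hullRef, ∀ q ∈ hullRef, ψ p = ψ' q →
      IsEnd p ∧ IsEnd q := by
  simp only [childMaps, List.pairwise_cons, List.mem_cons, List.not_mem_nil, or_false,
    forall_eq_or_imp, forall_eq, Prod.ext_iff, IsEnd]
  refine ⟨⟨?_, ?_, ?_⟩, ⟨?_, ?_⟩, ?_, ?_⟩ <;>
    try simp only [IsEmpty.forall_iff, implies_true, List.Pairwise.nil, and_true]
  all_goals
    rintro p ⟨h1, h2, h3⟩ q ⟨h4, h5, h6⟩ ⟨h7, h8⟩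
    constructor
    all_goals
      first
      | (exfalso; linarith)
      | (left; constructor <;> linarith)
      | (right; constructor <;> linarith)

/-! ### The polygonal regions -/

/-- The closed region bounded by the `k`-th polygon. -/
def solid : ℕ → Set Plane
  | 0 => inner rootEdge
  | k + 1 => solid k ∪ ⋃ e ∈ polygonSides k, bump e

/-- The union of the hulls over the sides of the `k`-th polygon. -/
def arcs (k : ℕ) : Set Plane := ⋃ e ∈ polygonSides k, hull e

/-- The `k`-th polygonal region together with everything that can still be added to it. -/
def outer (k : ℕ) : Set Plane := solid k ∪ arcs k

lemma mem_arcs {k : ℕ} {x : Plane} : x ∈ arcs k ↔ ∃ e ∈ polygonSides k, x ∈ hull e := by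
  simp [arcs]

lemma isClosed_hullRef : IsClosed hullRef := by
  refine (isClosed_le (f := fun _ : ℝ × ℝ => (0 : ℝ)) (g := fun p => p.2) ?_ ?_).inter
    ((isClosed_le (f := fun p : ℝ × ℝ => p.2) (g := fun p => p.1) ?_ ?_).inter
    (isClosed_le (f := fun p : ℝ × ℝ => p.1 + 2 * p.2) (g := fun _ => 1) ?_ ?_)) <;> fun_prop

lemma isClosed_bumpRef : IsClosed bumpRef := by
  refine (isClosed_le (f := fun _ : ℝ × ℝ => (0 : ℝ)) (g := fun p => p.2) ?_ ?_).inter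
    ((isClosed_le (f := fun _ : ℝ × ℝ => (1 / 3 : ℝ)) (g := fun p => p.1) ?_ ?_).inter
    (isClosed_le (f := fun p : ℝ × ℝ => p.1 + p.2) (g := fun _ => 2 / 3) ?_ ?_)) <;> fun_prop

lemma isClosed_innerRef : IsClosed innerRef := by
  refine (isClosed_le (f := fun p : ℝ × ℝ => p.2) (g := fun _ => 0) ?_ ?_).inter
    ((isClosed_le (f := fun p : ℝ × ℝ => p.1) (g := fun _ => 1) ?_ ?_).inter
    (isClosed_le (f := fun _ : ℝ × ℝ => (0 : ℝ)) (g := fun p => p.1 + p.2) ?_ ?_)) <;> fun_prop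

lemma isCompact_hullRef : IsCompact hullRef := by
  refine (isCompact_Icc (a := ((-2, -2) : ℝ × ℝ)) (b := (2, 2))).of_isClosed_subset
    isClosed_hullRef ?_
  rintro p ⟨h1, h2, h3⟩
  exact ⟨⟨by simp only []; linarith, by simp only []; linarith⟩,
    ⟨by simp only []; linarith, by simp only []; linarith⟩⟩

lemma isCompact_bumpRef : IsCompact bumpRef :=
  isCompact_hullRef.of_isClosed_subset isClosed_bumpRef bumpRef_subset_hullRef

lemma isCompact_innerRef : IsCompact innerRef := by
  refine (isCompact_Icc (a := ((-2, -2) : ℝ × ℝ)) (b := (2, 2))).of_isClosed_subset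
    isClosed_innerRef ?_
  rintro p ⟨h1, h2, h3⟩
  exact ⟨⟨by simp only []; linarith, by simp only []; linarith⟩,
    ⟨by simp only []; linarith, by simp only []; linarith⟩⟩

lemma isCompact_hull (e : Plane × Plane) : IsCompact (hull e) :=
  isCompact_hullRef.image (continuous_chart e)

lemma isCompact_arcs (k : ℕ) : IsCompact (arcs k) :=
  (polygonSides k).finite_toSet.isCompact_biUnion fun e _ => isCompact_hull e

lemma isCompact_solid (k : ℕ) : IsCompact (solid k) := by
  induction k with
  | zero => exact isCompact_innerRef.image (continuous_chart _)
  | succ k ih =>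
    exact ih.union ((polygonSides k).finite_toSet.isCompact_biUnion fun e _ =>
      isCompact_bumpRef.image (continuous_chart e))

lemma bump_subset_hull (e : Plane × Plane) : bump e ⊆ hull e :=
  image_mono bumpRef_subset_hullRef

lemma hull_subset_hull {e c : Plane × Plane} (h : c ∈ subdivide e) : hull c ⊆ hull e := by
  obtain ⟨ψ, hψ, rfl⟩ := mem_subdivide.1 h
  rintro _ ⟨p, hp, rfl⟩
  exact ⟨ψ p, mem_hullRef_of_mem_childMaps hψ hp, (chart_subEdge_of_mem hψ e p).symm⟩

lemma arcs_succ_subset (k : ℕ) : arcs (k + 1) ⊆ arcs k := by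
  intro x hx
  obtain ⟨c, hc, hx⟩ := mem_arcs.1 hx
  obtain ⟨e, he, hc⟩ := mem_polygonSides_succ.1 hc
  exact mem_arcs.2 ⟨e, he, hull_subset_hull hc hx⟩

lemma antitone_arcs : Antitone arcs := antitone_nat_of_succ_le arcs_succ_subset

lemma solid_subset_succ (k : ℕ) : solid k ⊆ solid (k + 1) := subset_union_left

lemma monotone_solid : Monotone solid := monotone_nat_of_le_succ solid_subset_succ

lemma bump_subset_solid {k : ℕ} {e : Plane × Plane} (he : e ∈ polygonSides k) :
    bump e ⊆ solid (k + 1) :=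
  (subset_biUnion_of_mem (u := bump) he).trans subset_union_right

lemma mem_solid_succ {k : ℕ} {x : Plane} :
    x ∈ solid (k + 1) ↔ x ∈ solid k ∨ ∃ e ∈ polygonSides k, x ∈ bump e := by
  simp [solid]

lemma antitone_outer : Antitone outer := by
  refine antitone_nat_of_succ_le fun k => ?_
  rintro x (hx | hx)
  · rcases mem_solid_succ.1 hx with hx | ⟨e, he, hx⟩
    · exact Or.inl hx
    · exact Or.inr (mem_arcs.2 ⟨e, he, bump_subset_hull e hx⟩)
  · exact Or.inr (arcs_succ_subset k hx)

/-! ### Separation of the hulls -/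

/-- The hulls over two segments meet at most in common end points. -/
def MeetAtEnds (e e' : Plane × Plane) : Prop :=
  ∀ x, x ∈ hull e → x ∈ hull e' → (x = e.1 ∨ x = e.2) ∧ (x = e'.1 ∨ x = e'.2)

lemma IsEnd.chart {p : ℝ × ℝ} (h : IsEnd p) (e : Plane × Plane) :
    chart e p = e.1 ∨ chart e p = e.2 := by
  rcases h with rfl | rfl
  · exact Or.inl (chart_zero e)
  · exact Or.inr (chart_one e)

lemma isEnd_of_chart {e : Plane × Plane} (he : 0 < ‖e.2 - e.1‖) {p : ℝ × ℝ}
    (h : chart e p = e.1 ∨ chart e p = e.2) : IsEnd p := by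
  rcases h with h | h
  · exact Or.inl (chart_injective he (h.trans (chart_zero e).symm))
  · exact Or.inr (chart_injective he (h.trans (chart_one e).symm))

/-- An end point of `e` is an end point of every new segment whose hull contains it. -/
lemma end_of_mem_hull_child {e c : Plane × Plane} (he : 0 < ‖e.2 - e.1‖) (hc : c ∈ subdivide e)
    {x : Plane} (hx : x ∈ hull c) (h : x = e.1 ∨ x = e.2) : x = c.1 ∨ x = c.2 := by
  obtain ⟨ψ, hψ, rfl⟩ := mem_subdivide.1 hc
  obtain ⟨p, hp, rfl⟩ := hx
  rw [chart_subEdge_of_mem hψ] at h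
  exact (isEnd_of_isEnd_childMaps hψ hp (isEnd_of_chart he h)).chart _

lemma pairwise_subdivide {e : Plane × Plane} (he : 0 < ‖e.2 - e.1‖) :
    (subdivide e).Pairwise MeetAtEnds := by
  rw [subdivide_eq, List.pairwise_map]
  refine pairwise_childMaps.imp_of_mem fun {ψ ψ'} hψ hψ' h => ?_
  rintro _ ⟨p, hp, rfl⟩ ⟨q, hq, hpq⟩
  have h1 := h p hp q hq (chart_injective he (by
    rw [← chart_subEdge_of_mem hψ, ← chart_subEdge_of_mem hψ', hpq]))
  exact ⟨h1.1.chart _, hpq ▸ h1.2.chart _⟩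

lemma rootEdge_mem : rootEdge ∈ polygonSides 0 := by simp [polygonSides, rootEdge]

lemma pairwise_polygonSides_zero : (polygonSides 0).Pairwise MeetAtEnds := by
  have hr := norm_polygonSides_pos rootEdge_mem
  have key : ∀ ψ ψ' : ℝ × ℝ → ℝ × ℝ, IsFrameChange ψ → IsFrameChange ψ' →
      (∀ p ∈ hullRef, ∀ q ∈ hullRef, ψ p = ψ' q → IsEnd p ∧ IsEnd q) →
      MeetAtEnds (subEdge rootEdge ψ) (subEdge rootEdge ψ') := by
    rintro ψ ψ' hψ hψ' h _ ⟨p, hp, rfl⟩ ⟨q, hq, hpq⟩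
    have h1 := h p hp q hq (chart_injective hr (by
      rw [← hψ.chart_subEdge, ← hψ'.chart_subEdge, hpq]))
    exact ⟨h1.1.chart _, hpq ▸ h1.2.chart _⟩
  rw [polygonSides_zero]
  simp only [List.pairwise_cons, List.mem_cons, List.not_mem_nil, or_false, forall_eq_or_imp,
    forall_eq, IsEmpty.forall_iff, implies_true, List.Pairwise.nil, and_true]
  refine ⟨⟨key _ _ isFrameChange_id isFrameChange_turn ?_,
    key _ _ isFrameChange_id isFrameChange_turn_turn ?_⟩,
    key _ _ isFrameChange_turn isFrameChange_turn_turn ?_⟩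
  all_goals
    simp only [turn, Function.comp, id, Prod.ext_iff, IsEnd]
    rintro p ⟨h1, h2, h3⟩ q ⟨h4, h5, h6⟩ ⟨h7, h8⟩
    constructor
    all_goals
      first
      | (left; constructor <;> linarith)
      | (right; constructor <;> linarith)

lemma pairwise_polygonSides (k : ℕ) : (polygonSides k).Pairwise MeetAtEnds := by
  induction k with
  | zero => exact pairwise_polygonSides_zero
  | succ k ih =>
    rw [polygonSides, List.pairwise_flatMap]
    refine ⟨fun e he => pairwise_subdivide (norm_polygonSides_pos he),
      ih.imp_of_mem fun {e e'} he he' h c hc c' hc' x hx hx' => ?_⟩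
    have h1 := h x (hull_subset_hull hc hx) (hull_subset_hull hc' hx')
    exact ⟨end_of_mem_hull_child (norm_polygonSides_pos he) hc hx h1.1,
      end_of_mem_hull_child (norm_polygonSides_pos he') hc' hx' h1.2⟩

lemma meetAtEnds_of_ne {k : ℕ} {e e' : Plane × Plane} (he : e ∈ polygonSides k)
    (he' : e' ∈ polygonSides k) (hne : e ≠ e') : MeetAtEnds e e' := by
  have : Std.Symm MeetAtEnds := ⟨fun _ _ h x hx hx' => (h x hx' hx).symm⟩
  exact (pairwise_polygonSides k).forall he he' hne

/-! ### The sides of the polygonal regions -/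

lemma inner_subEdge_turn (e : Plane × Plane) : inner (subEdge e turn) = inner e := by
  refine Subset.antisymm ?_ ?_
  · rintro _ ⟨p, ⟨h1, h2, h3⟩, rfl⟩
    rw [isFrameChange_turn.chart_subEdge]
    refine ⟨_, ⟨?_, ?_, ?_⟩, rfl⟩ <;> simp only [turn] <;> linarith
  · rintro _ ⟨p, ⟨h1, h2, h3⟩, rfl⟩
    refine ⟨(1 - p.1 - p.2, p.1 - 1), ⟨by dsimp only; linarith, by dsimp only; linarith,
      by dsimp only; linarith⟩, ?_⟩
    rw [isFrameChange_turn.chart_subEdge]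
    congr 1
    ext <;> simp only [turn] <;> ring

lemma subEdge_turn_turn (e : Plane × Plane) :
    subEdge e (turn ∘ turn) = subEdge (subEdge e turn) turn := by
  rw [subEdge, subEdge, isFrameChange_turn.chart_subEdge, isFrameChange_turn.chart_subEdge]
  rfl

lemma subEdge_id (e : Plane × Plane) : subEdge e id = e := by
  simp [subEdge, chart_zero, chart_one]

lemma inner_eq_of_mem_zero {e : Plane × Plane} (he : e ∈ polygonSides 0) :
    inner e = inner rootEdge := by
  rw [polygonSides_zero] at he
  simp only [List.mem_cons, List.not_mem_nil, or_false] at he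
  rcases he with rfl | rfl | rfl
  · rw [subEdge_id]
  · rw [inner_subEdge_turn]
  · rw [subEdge_turn_turn, inner_subEdge_turn, inner_subEdge_turn]

/-- A polygonal region meets the hulls over its sides only in the sides. -/
lemma snd_eq_zero_of_mem_solid {k : ℕ} {e : Plane × Plane} (he : e ∈ polygonSides k)
    {p : ℝ × ℝ} (hp : p ∈ hullRef) (hx : chart e p ∈ solid k) : p.2 = 0 := by
  induction k generalizing e p with
  | zero =>
    rw [solid, ← inner_eq_of_mem_zero he] at hx
    obtain ⟨q, hq, hpq⟩ := hx
    obtain rfl := chart_injective (norm_polygonSides_pos he) hpq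
    exact le_antisymm hq.1 hp.1
  | succ k ih =>
    obtain ⟨e', he', hc⟩ := mem_polygonSides_succ.1 he
    have hpos := norm_polygonSides_pos he'
    have hend : ∀ {x}, x ∈ hull e → (x = e'.1 ∨ x = e'.2) → x = e.1 ∨ x = e.2 :=
      end_of_mem_hull_child hpos hc
    have hzero : (chart e p = e.1 ∨ chart e p = e.2) → p.2 = 0 := fun h => by
      rcases isEnd_of_chart (norm_polygonSides_pos he) h with rfl | rfl <;> rfl
    have hsub := hull_subset_hull hc
    replace hx := mem_solid_succ.1 hx
    rcases hx with hx | ⟨f, hf, hx⟩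
    · obtain ⟨ψ, hψ, rfl⟩ := mem_subdivide.1 hc
      rw [chart_subEdge_of_mem hψ] at hx
      have h := ih he' (mem_hullRef_of_mem_childMaps hψ hp) hx
      obtain ⟨h1, h2, h3⟩ := hp
      revert h
      clear hx hend hzero hsub hc he
      revert ψ
      rw [forall_mem_childMaps]
      refine ⟨?_, ?_, ?_, ?_⟩ <;> intro h <;> linarith
    · by_cases hne : e' = f
      · subst hne
        obtain ⟨ψ, hψ, rfl⟩ := mem_subdivide.1 hc
        rw [chart_subEdge_of_mem hψ] at hx
        obtain ⟨q, hq, hpq⟩ := hx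
        have h := chart_injective hpos hpq ▸ hq
        obtain ⟨h1, h2, h3⟩ := hp
        clear hend hzero hsub hc he hq hpq
        revert h
        revert ψ
        rw [forall_mem_childMaps]
        refine ⟨?_, ?_, ?_, ?_⟩ <;> rintro ⟨h4, h5, h6⟩ <;> dsimp only at h4 h5 h6 <;> linarith
      · have h := meetAtEnds_of_ne he' hf hne _ (hsub ⟨p, hp, rfl⟩) (bump_subset_hull f hx)
        exact hzero (hend ⟨p, hp, rfl⟩ h.1)

lemma inner_child_subset {e c : Plane × Plane} (h : c ∈ subdivide e) :
    inner c ⊆ inner e ∪ bump e := by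
  obtain ⟨ψ, hψ, rfl⟩ := mem_subdivide.1 h
  rw [inner, inner, bump, ← image_union]
  rintro _ ⟨p, ⟨h1, h2, h3⟩, rfl⟩
  rw [chart_subEdge_of_mem hψ]
  refine ⟨_, ?_, rfl⟩
  clear h
  revert ψ
  rw [forall_mem_childMaps]
  simp only [mem_union, innerRef, bumpRef, mem_ofPred_eq]
  refine ⟨Or.inl ⟨?_, ?_, ?_⟩, Or.inr ⟨?_, ?_, ?_⟩, Or.inr ⟨?_, ?_, ?_⟩, Or.inl ⟨?_, ?_, ?_⟩⟩ <;>
    linarith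

lemma inner_subset_solid {k : ℕ} {e : Plane × Plane} (he : e ∈ polygonSides k) :
    inner e ⊆ solid k := by
  induction k generalizing e with
  | zero => exact (inner_eq_of_mem_zero he).le
  | succ k ih =>
    obtain ⟨e', he', hc⟩ := mem_polygonSides_succ.1 he
    exact (inner_child_subset hc).trans
      (union_subset ((ih he').trans (solid_subset_succ k)) (bump_subset_solid he'))

lemma mem_polygonCurve {k : ℕ} {x : Plane} :
    x ∈ polygonCurve k ↔ ∃ e ∈ polygonSides k, ∃ t ∈ Icc (0 : ℝ) 1, chart e (t, 0) = x := by
  simp only [polygonCurve, segment_eq_chart_image, mem_iUnion, mem_image, exists_prop]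

lemma mem_polygonCurve_succ {k : ℕ} {e : Plane × Plane} (he : e ∈ polygonSides k)
    {ψ : ℝ × ℝ → ℝ × ℝ} (hψ : ψ ∈ childMaps) {t : ℝ} (ht : t ∈ Icc (0 : ℝ) 1) {p : ℝ × ℝ}
    (hp : ψ (t, 0) = p) : chart e p ∈ polygonCurve (k + 1) :=
  mem_polygonCurve.2 ⟨subEdge e ψ, mem_polygonSides_succ.2 ⟨e, he, mem_subdivide.2 ⟨ψ, hψ, rfl⟩⟩,
    t, ht, by rw [chart_subEdge_of_mem hψ, hp]⟩

lemma frontier_inner_subset {e : Plane × Plane} (he : 0 < ‖e.2 - e.1‖) {x : Plane}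
    (hx : x ∈ frontier (inner e)) :
    ∃ p : ℝ × ℝ, chart e p = x ∧ p ∈ innerRef ∧ (p.2 = 0 ∨ p.1 = 1 ∨ p.1 + p.2 = 0) := by
  rw [inner, (isCompact_innerRef.image (continuous_chart e)).isClosed.frontier_eq] at hx
  obtain ⟨⟨p, hp, rfl⟩, hx⟩ := hx
  refine ⟨p, rfl, hp, ?_⟩
  by_contra! h
  obtain ⟨h1, h2, h3⟩ := hp
  apply hx
  have ho : IsOpen ({p | p.2 < 0} ∩ ({p | p.1 < 1} ∩ {p | 0 < p.1 + p.2}) : Set (ℝ × ℝ)) :=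
    (isOpen_lt (by fun_prop) (by fun_prop)).inter
      ((isOpen_lt (by fun_prop) (by fun_prop)).inter (isOpen_lt (by fun_prop) (by fun_prop)))
  refine interior_maximal (image_mono ?_) (isOpenMap_chart he _ ho)
    (mem_image_of_mem _ ⟨lt_of_le_of_ne h1 h.1, lt_of_le_of_ne h2 h.2.1,
      lt_of_le_of_ne h3 h.2.2.symm⟩)
  rintro q ⟨h4, h5, h6⟩
  exact ⟨le_of_lt h4, le_of_lt h5, le_of_lt h6⟩

/-- The bump and the inner triangle together are a neighbourhood of the open middle third of `e`
and of the interior of the bump. -/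
lemma mem_interior_solid_succ {k : ℕ} {e : Plane × Plane} (he : e ∈ polygonSides k) {p : ℝ × ℝ}
    (h1 : 1 / 3 < p.1) (h2 : p.1 + p.2 < 2 / 3) (h3 : p.1 < 1) (h4 : 0 < p.1 + p.2) :
    chart e p ∈ interior (solid (k + 1)) := by
  have ho : IsOpen ({p | 1 / 3 < p.1} ∩ {p | p.1 + p.2 < 2 / 3} ∩
      ({p | p.1 < 1} ∩ {p | 0 < p.1 + p.2}) : Set (ℝ × ℝ)) :=
    ((isOpen_lt (by fun_prop) (by fun_prop)).inter (isOpen_lt (by fun_prop) (by fun_prop))).inter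
      ((isOpen_lt (by fun_prop) (by fun_prop)).inter (isOpen_lt (by fun_prop) (by fun_prop)))
  refine interior_maximal ?_ (isOpenMap_chart (norm_polygonSides_pos he) _ ho)
    (mem_image_of_mem _ ⟨⟨h1, h2⟩, h3, h4⟩)
  rintro _ ⟨q, ⟨⟨h5, h6⟩, h7, h8⟩, rfl⟩
  simp only [mem_ofPred_eq] at h5 h6 h7 h8
  rcases le_total 0 q.2 with h | h
  · exact bump_subset_solid he ⟨q, ⟨h, h5.le, h6.le⟩, rfl⟩
  · exact solid_subset_succ k (inner_subset_solid he ⟨q, ⟨h, h7.le, h8.le⟩, rfl⟩)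

lemma frontier_solid_subset (k : ℕ) : frontier (solid k) ⊆ polygonCurve k := by
  induction k with
  | zero =>
    intro x hx
    have hr := norm_polygonSides_pos rootEdge_mem
    obtain ⟨p, rfl, ⟨h1, h2, h3⟩, h | h | h⟩ := frontier_inner_subset hr hx
    · refine mem_polygonCurve.2 ⟨rootEdge, rootEdge_mem, p.1, ⟨?_, ?_⟩, ?_⟩ <;> try linarith
      rw [← h]
    · refine mem_polygonCurve.2 ⟨subEdge rootEdge turn, ?_, -p.2, ⟨?_, ?_⟩, ?_⟩ <;> try linarith
      · simp [polygonSides_zero]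
      · rw [isFrameChange_turn.chart_subEdge, turn]
        congr 1
        ext <;> simp [h]
    · refine mem_polygonCurve.2 ⟨subEdge rootEdge (turn ∘ turn), ?_, 1 - p.1, ⟨?_, ?_⟩, ?_⟩ <;>
        try linarith
      · simp [polygonSides_zero]
      · rw [isFrameChange_turn_turn.chart_subEdge]
        congr 1
        ext <;> simp [turn]; linarith
  | succ k ih =>
    have hside : ∀ e ∈ polygonSides k, ∀ t ∈ Icc (0 : ℝ) 1,
        chart e (t, 0) ∉ interior (solid (k + 1)) → chart e (t, 0) ∈ polygonCurve (k + 1) := by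
      rintro e he t ⟨h0, h1⟩ hx
      rcases le_or_gt t (1 / 3) with h | h
      · refine mem_polygonCurve_succ he (ψ := fun p => (p.1 / 3, p.2 / 3)) (by simp [childMaps])
          (t := 3 * t) ⟨by linarith, by linarith⟩ ?_
        ext <;> simp
      · rcases le_or_gt (2 / 3) t with h' | h'
        · refine mem_polygonCurve_succ he (ψ := fun p => (2 / 3 + p.1 / 3, p.2 / 3))
            (by simp [childMaps]) (t := 3 * t - 2) ⟨by linarith, by linarith⟩ ?_
          ext <;> simp; ring
        · exact absurd (mem_interior_solid_succ he h (by simpa using h') (by simp only []; linarith)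
            (by simp only []; linarith)) hx
    rw [(isCompact_solid _).isClosed.frontier_eq]
    rintro x ⟨hx, hxi⟩
    rcases mem_solid_succ.1 hx with hx | ⟨e, he, p, ⟨h1, h2, h3⟩, rfl⟩
    · have hf : x ∈ frontier (solid k) := by
        rw [(isCompact_solid _).isClosed.frontier_eq]
        exact ⟨hx, fun h => hxi (interior_mono (solid_subset_succ k) h)⟩
      obtain ⟨e, he, t, ht, rfl⟩ := mem_polygonCurve.1 (ih hf)
      exact hside e he t ht hxi
    · rcases h2.eq_or_lt with h | h
      · refine mem_polygonCurve_succ he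
          (ψ := fun p => (1 / 3 - p.2 / 3, p.1 / 3 + p.2 / 3)) (by simp [childMaps])
          (t := 3 * p.2) ⟨by linarith, by linarith⟩ ?_
        ext <;> simp; linarith
      · rcases h3.eq_or_lt with h' | h'
        · refine mem_polygonCurve_succ he
            (ψ := fun p => (1 / 3 + p.1 / 3 + p.2 / 3, 1 / 3 - p.1 / 3)) (by simp [childMaps])
            (t := 3 * p.1 - 1) ⟨by linarith, by linarith⟩ ?_
          ext <;> simp <;> linarith
        · exact absurd (mem_interior_solid_succ he h h' (by linarith) (by linarith)) hxi

/-! ### The limit curve -/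

lemma dist_fst_le_of_mem_hull {e : Plane × Plane} {x : Plane} (hx : x ∈ hull e) :
    dist x e.1 ≤ ‖e.2 - e.1‖ := by
  obtain ⟨p, ⟨h1, h2, h3⟩, rfl⟩ := hx
  rw [dist_eq_norm, ← sq_le_sq₀ (norm_nonneg _) (norm_nonneg _)]
  conv_lhs => rw [← chart_zero e]
  rw [norm_chart_sub_sq]
  refine mul_le_of_le_one_left (by positivity) ?_
  nlinarith [mul_nonneg h1 (sub_nonneg.2 h2), mul_nonneg h1 h1]

lemma polygonCurve_subset_arcs (k : ℕ) : polygonCurve k ⊆ arcs k := by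
  intro x hx
  obtain ⟨e, he, t, ⟨h0, h1⟩, rfl⟩ := mem_polygonCurve.1 hx
  exact mem_arcs.2 ⟨e, he, (t, 0), ⟨le_rfl, h0, by simpa using h1⟩, rfl⟩

lemma fst_mem_polygonCurve {k : ℕ} {e : Plane × Plane} (he : e ∈ polygonSides k) :
    e.1 ∈ polygonCurve k :=
  mem_polygonCurve.2 ⟨e, he, 0, ⟨le_rfl, zero_le_one⟩, chart_zero e⟩

lemma polygonCurve_nonempty (k : ℕ) : (polygonCurve k).Nonempty := by
  obtain ⟨e, he⟩ := List.exists_mem_of_ne_nil _ (polygonSides_ne_nil k)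
  exact ⟨e.1, fst_mem_polygonCurve he⟩

/-- The limit curve is the decreasing intersection of the unions of the hulls. -/
lemma kochCurve_eq_iInter_arcs : kochCurve = ⋂ k, arcs k := by
  ext x
  simp only [kochCurve, mem_ofPred_eq, mem_iInter]
  constructor
  · intro hx k
    have hne : (arcs k).Nonempty := (polygonCurve_nonempty k).mono (polygonCurve_subset_arcs k)
    rw [(isCompact_arcs k).isClosed.mem_iff_infDist_zero hne]
    refine le_antisymm (ge_of_tendsto hx ?_) Metric.infDist_nonneg
    filter_upwards [eventually_ge_atTop k] with m hm
    exact Metric.infDist_le_infDist_of_subset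
      ((polygonCurve_subset_arcs m).trans (antitone_arcs hm)) (polygonCurve_nonempty m)
  · intro hx
    refine squeeze_zero (fun _ => Metric.infDist_nonneg) (fun k => ?_)
      (tendsto_pow_atTop_nhds_zero_of_lt_one (r := (1 / 3 : ℝ)) (by norm_num) (by norm_num))
    obtain ⟨e, he, hxe⟩ := mem_arcs.1 (hx k)
    rw [← norm_polygonSides he]
    exact (Metric.infDist_le_dist_of_mem (fst_mem_polygonCurve he)).trans
      (dist_fst_le_of_mem_hull hxe)

lemma kochCurve_subset_arcs (k : ℕ) : kochCurve ⊆ arcs k :=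
  kochCurve_eq_iInter_arcs ▸ iInter_subset _ k

lemma isCompact_kochCurve : IsCompact kochCurve := by
  refine (isCompact_arcs 0).of_isClosed_subset ?_ (kochCurve_subset_arcs 0)
  rw [kochCurve_eq_iInter_arcs]
  exact isClosed_iInter fun k => (isCompact_arcs k).isClosed

lemma kochCurve_subset_outer (k : ℕ) : kochCurve ⊆ outer k :=
  (kochCurve_subset_arcs k).trans subset_union_right

/-! ### Exterior points -/

/-- The point `x` can be joined to infinity off the limit curve. -/
def Escapes (x : Plane) : Prop :=
  ∃ A : Set Plane, IsPreconnected A ∧ x ∈ A ∧ ¬ Bornology.IsBounded A ∧ A ⊆ kochCurveᶜ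

lemma Escapes.of_isPreconnected {B : Set Plane} (hB : IsPreconnected B) (hBK : B ⊆ kochCurveᶜ)
    {x y : Plane} (hx : x ∈ B) (hy : y ∈ B) (h : Escapes y) : Escapes x := by
  obtain ⟨A, hA, hyA, hb, hAK⟩ := h
  exact ⟨B ∪ A, hB.union y hy hyA hA, Or.inl hx, fun h => hb (h.subset subset_union_right),
    union_subset hBK hAK⟩

lemma Escapes.notMem_snowflake {x : Plane} (h : Escapes x) : x ∉ snowflake := by
  obtain ⟨A, hA, hx, hb, hAK⟩ := h
  exact fun hs => hb (hs.2.subset (hA.subset_connectedComponentIn hx hAK))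

/-- In coordinates, the union of the inner triangle and the hull, which is a convex kite. -/
def kiteRef : Set (ℝ × ℝ) :=
  {p | 0 ≤ p.1 + p.2} ∩ {p | p.1 ≤ 1} ∩ ({p | p.2 ≤ p.1} ∩ {p | p.1 + 2 * p.2 ≤ 1})

lemma kiteRef_eq : kiteRef = innerRef ∪ hullRef := by
  ext p
  simp only [kiteRef, innerRef, hullRef, mem_inter_iff, mem_union, mem_ofPred_eq]
  constructor
  · rintro ⟨⟨h1, h2⟩, h3, h4⟩
    rcases le_total 0 p.2 with h | h
    · exact Or.inr ⟨h, h3, h4⟩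
    · exact Or.inl ⟨h, h2, h1⟩
  · rintro (⟨h1, h2, h3⟩ | ⟨h1, h2, h3⟩) <;> refine ⟨⟨?_, ?_⟩, ?_, ?_⟩ <;> linarith

lemma convex_kiteRef : Convex ℝ kiteRef := by
  rintro p ⟨⟨h1, h2⟩, h3, h4⟩ q ⟨⟨h5, h6⟩, h7, h8⟩ a b ha hb hab
  simp only [mem_ofPred_eq] at *
  refine ⟨⟨?_, ?_⟩, ?_, ?_⟩ <;>
    simp only [mem_ofPred_eq, Prod.fst_add, Prod.snd_add, Prod.smul_fst, Prod.smul_snd,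
      smul_eq_mul] <;>
    nlinarith

/-- The barycentre of the initial triangle. -/
noncomputable def centre : Plane := chart rootEdge (2 / 3, -1 / 3)

lemma chart_centre {e : Plane × Plane} (he : e ∈ polygonSides 0) :
    chart e (2 / 3, -1 / 3) = centre := by
  rw [polygonSides_zero] at he
  simp only [List.mem_cons, List.not_mem_nil, or_false] at he
  rcases he with rfl | rfl | rfl
  · rw [subEdge_id, centre]
  · rw [isFrameChange_turn.chart_subEdge, centre, turn]
    norm_num
  · rw [isFrameChange_turn_turn.chart_subEdge, centre, Function.comp, turn, turn]
    norm_num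

lemma starConvex_outer_zero : StarConvex ℝ centre (outer 0) := by
  have h : outer 0 = ⋃ e ∈ polygonSides 0, chart e '' kiteRef := by
    ext x
    simp only [outer, solid, mem_union, mem_arcs, mem_iUnion, kiteRef_eq, image_union, exists_prop]
    constructor
    · rintro (h | ⟨e, he, h⟩)
      · exact ⟨rootEdge, rootEdge_mem, Or.inl h⟩
      · exact ⟨e, he, Or.inr h⟩
    · rintro ⟨e, he, h | h⟩
      · exact Or.inl (inner_eq_of_mem_zero he ▸ h)
      · exact Or.inr ⟨e, he, h⟩
  rw [h]
  refine starConvex_iUnion₂ fun e he => ?_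
  refine (convex_chart_image e convex_kiteRef).starConvex ?_
  rw [← chart_centre he]
  refine mem_image_of_mem _ ⟨⟨?_, ?_⟩, ?_, ?_⟩ <;> simp only [mem_ofPred_eq] <;> norm_num

/-- A point outside the star-shaped set `outer 0` escapes along the ray from the centre. -/
lemma escapes_of_notMem_outer_zero {x : Plane} (hx : x ∉ outer 0) : Escapes x := by
  have hc : centre ∈ outer 0 := by
    refine Or.inl (mem_image_of_mem _ ⟨?_, ?_, ?_⟩) <;> norm_num
  have hne : x - centre ≠ 0 := sub_ne_zero.2 fun h => hx (h ▸ hc)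
  refine ⟨(fun t : ℝ => centre + t • (x - centre)) '' Ici 1,
    isPreconnected_Ici.image _ (by fun_prop), ⟨1, self_mem_Ici, by simp⟩, ?_, ?_⟩
  · intro hb
    obtain ⟨R, hR⟩ := hb.exists_norm_le
    have h : Tendsto (fun t : ℝ => t * ‖x - centre‖ - ‖centre‖) atTop atTop :=
      tendsto_atTop_add_const_right _ _ (tendsto_id.atTop_mul_const (norm_pos_iff.2 hne))
    obtain ⟨t, ht, ht1⟩ := ((h.eventually_gt_atTop R).and (eventually_ge_atTop 1)).exists
    have h1 := hR _ ⟨t, ht1, rfl⟩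
    have h2 := norm_sub_le (centre + t • (x - centre)) centre
    rw [add_sub_cancel_left, norm_smul, Real.norm_of_nonneg (by linarith)] at h2
    linarith
  · rintro _ ⟨t, ht, rfl⟩ hK
    rw [mem_Ici] at ht
    apply hx
    have h1 := starConvex_outer_zero (kochCurve_subset_outer 0 hK)
      (a := 1 - t⁻¹) (b := t⁻¹) (sub_nonneg.2 (inv_le_one_of_one_le₀ ht)) (by positivity) (by ring)
    convert h1 using 1
    rw [smul_add, smul_smul, inv_mul_cancel₀ (by positivity)]
    module

lemma convex_leftGapRef : Convex ℝ leftGapRef := by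
  have h1 : IsLinearMap ℝ fun p : ℝ × ℝ => p.2 - p.1 :=
    ⟨fun _ _ => by simp; ring, fun _ _ => by simp; ring⟩
  have h2 : IsLinearMap ℝ fun p : ℝ × ℝ => p.1 + 2 * p.2 :=
    ⟨fun _ _ => by simp; ring, fun _ _ => by simp; ring⟩
  have h3 : IsLinearMap ℝ fun p : ℝ × ℝ => 2 * p.1 + p.2 :=
    ⟨fun _ _ => by simp; ring, fun _ _ => by simp; ring⟩
  have h : leftGapRef = {p | p.2 - p.1 ≤ 0} ∩
      ({p | 1 / 3 < p.1 + 2 * p.2} ∩ {p | 2 * p.1 + p.2 < 2 / 3}) := by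
    ext p
    simp [leftGapRef]
  exact h ▸ (convex_halfSpace_le h1 0).inter
    ((convex_halfSpace_gt h2 (1 / 3)).inter (convex_halfSpace_lt h3 (2 / 3)))

lemma convex_rightGapRef : Convex ℝ rightGapRef := by
  have h1 : IsLinearMap ℝ fun p : ℝ × ℝ => p.1 - p.2 :=
    ⟨fun _ _ => by simp; ring, fun _ _ => by simp; ring⟩
  have h2 : IsLinearMap ℝ fun p : ℝ × ℝ => p.1 + 2 * p.2 :=
    ⟨fun _ _ => by simp; ring, fun _ _ => by simp; ring⟩
  have h3 : IsLinearMap ℝ fun p : ℝ × ℝ => 2 * p.1 + p.2 :=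
    ⟨fun _ _ => by simp; ring, fun _ _ => by simp; ring⟩
  have h : rightGapRef = {p | p.1 + 2 * p.2 ≤ 1} ∩
      ({p | p.1 - p.2 < 2 / 3} ∩ {p | 4 / 3 < 2 * p.1 + p.2}) := by
    ext p
    simp [rightGapRef]
  exact h ▸ (convex_halfSpace_le h2 1).inter
    ((convex_halfSpace_lt h1 (2 / 3)).inter (convex_halfSpace_gt h3 (4 / 3)))

/-- The hull is covered by the bump, the four smaller hulls and the two gaps. -/
lemma hullRef_cover {p : ℝ × ℝ} (hp : p ∈ hullRef) :
    p ∈ leftGapRef ∪ rightGapRef ∨ p ∈ bumpRef ∨ ∃ ψ ∈ childMaps, ∃ q ∈ hullRef, ψ q = p := by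
  obtain ⟨h1, h2, h3⟩ := hp
  simp only [childMaps, List.mem_cons, List.not_mem_nil, or_false, exists_eq_or_imp,
    exists_eq_left]
  by_cases a1 : p.1 + 2 * p.2 ≤ 1 / 3
  · refine Or.inr (Or.inr (Or.inl ⟨(3 * p.1, 3 * p.2), ⟨?_, ?_, ?_⟩, by ext <;> simp⟩)) <;>
      dsimp only <;> linarith
  by_cases a2 : 2 / 3 ≤ p.1 - p.2
  · refine Or.inr (Or.inr (Or.inr (Or.inr (Or.inr
      ⟨(3 * p.1 - 2, 3 * p.2), ⟨?_, ?_, ?_⟩, by ext <;> simp; ring⟩)))) <;>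
      dsimp only <;> linarith
  by_cases a3 : p.1 ≤ 1 / 3
  · by_cases a4 : 2 * p.1 + p.2 < 2 / 3
    · exact Or.inl (Or.inl ⟨h2, by linarith, a4⟩)
    · refine Or.inr (Or.inr (Or.inr (Or.inl ⟨(3 * p.1 + 3 * p.2 - 1, 1 - 3 * p.1),
        ⟨?_, ?_, ?_⟩, by ext <;> simp <;> ring⟩))) <;> dsimp only <;> linarith
  by_cases a5 : p.1 + p.2 ≤ 2 / 3
  · exact Or.inr (Or.inl ⟨h1, by linarith, a5⟩)
  by_cases a6 : 4 / 3 < 2 * p.1 + p.2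
  · exact Or.inl (Or.inr ⟨h3, by linarith, a6⟩)
  · refine Or.inr (Or.inr (Or.inr (Or.inr (Or.inl ⟨(1 - 3 * p.2, 3 * p.1 + 3 * p.2 - 2),
      ⟨?_, ?_, ?_⟩, by ext <;> simp <;> ring⟩)))) <;> dsimp only <;> linarith

/-- The gaps lie in the hull, off its base, the bump and the smaller hulls. -/
lemma gapRef_spec {p : ℝ × ℝ} (hp : p ∈ leftGapRef ∪ rightGapRef) :
    p ∈ hullRef ∧ 0 < p.2 ∧ p ∉ bumpRef ∧ ∀ ψ ∈ childMaps, ∀ q ∈ hullRef, ψ q ≠ p := by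
  rw [forall_mem_childMaps]
  simp only [ne_eq, Prod.ext_iff]
  rcases hp with ⟨h1, h2, h3⟩ | ⟨h1, h2, h3⟩
  all_goals
    refine ⟨⟨by linarith, by linarith, by linarith⟩, by linarith, ?_, ?_, ?_, ?_, ?_⟩
    · rintro ⟨h4, h5, h6⟩
      linarith
    all_goals
      rintro q ⟨h4, h5, h6⟩ ⟨h7, h8⟩
      linarith

lemma notMem_outer_succ_of_gap {k : ℕ} {e : Plane × Plane} (he : e ∈ polygonSides k) {p : ℝ × ℝ}
    (hp : p ∈ leftGapRef ∪ rightGapRef) : chart e p ∉ outer (k + 1) := by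
  obtain ⟨hph, hpos, hpb, hpc⟩ := gapRef_spec hp
  have hinj := chart_injective (norm_polygonSides_pos he)
  have hother : ∀ e' ∈ polygonSides k, e ≠ e' → chart e p ∉ hull e' := by
    intro e' he' hne hx
    rcases isEnd_of_chart (norm_polygonSides_pos he)
      (meetAtEnds_of_ne he he' hne _ ⟨p, hph, rfl⟩ hx).1 with rfl | rfl <;> simp at hpos
  rintro (hx | hx)
  · rcases mem_solid_succ.1 hx with hx | ⟨e', he', hx⟩
    · exact hpos.ne' (snd_eq_zero_of_mem_solid he hph hx)
    · by_cases hne : e = e'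
      · subst hne
        obtain ⟨q, hq, hqp⟩ := hx
        exact hpb (hinj hqp ▸ hq)
      · exact hother e' he' hne (bump_subset_hull e' hx)
  · obtain ⟨c, hc, hx⟩ := mem_arcs.1 hx
    obtain ⟨e', he', hc⟩ := mem_polygonSides_succ.1 hc
    by_cases hne : e = e'
    · subst hne
      obtain ⟨ψ, hψ, rfl⟩ := mem_subdivide.1 hc
      obtain ⟨q, hq, hqp⟩ := hx
      rw [chart_subEdge_of_mem hψ] at hqp
      exact hpc ψ hψ q hq (hinj hqp)
    · exact hother e' he' hne (hull_subset_hull hc hx)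

/-- From a point `m` of a gap on the outer edge of the hull, one can leave `outer k` along any
direction `v` that points out of the hull. -/
lemma exists_exit {k : ℕ} {e : Plane × Plane} (he : e ∈ polygonSides k) {m v : ℝ × ℝ}
    (hm : m ∈ leftGapRef ∪ rightGapRef) (hv : ∀ t : ℝ, 0 < t → m + t • v ∉ hullRef) :
    ∃ ε : ℝ, 0 < ε ∧ ∀ t ∈ Ioc 0 ε, chart e (m + t • v) ∉ outer k := by
  obtain ⟨hmh, hpos, -, -⟩ := gapRef_spec hm
  have hpe := norm_polygonSides_pos he
  set C : Set Plane := solid k ∪ ⋃ e' ∈ {e' | e' ∈ polygonSides k ∧ e ≠ e'}, hull e' with hC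
  have hCc : IsClosed C := by
    refine (isCompact_solid k).isClosed.union (Set.Finite.isClosed_biUnion ?_ fun e' _ =>
      (isCompact_hull e').isClosed)
    exact (polygonSides k).finite_toSet.subset fun _ h => h.1
  have hmC : chart e (m + (0 : ℝ) • v) ∈ Cᶜ := by
    rw [zero_smul, add_zero]
    rintro (hx | hx)
    · exact hpos.ne' (snd_eq_zero_of_mem_solid he hmh hx)
    · simp only [mem_iUnion] at hx
      obtain ⟨e', ⟨he', hne⟩, hx⟩ := hx
      have hend := (meetAtEnds_of_ne he he' hne _ ⟨m, hmh, rfl⟩ hx).1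
      rcases isEnd_of_chart hpe hend with rfl | rfl <;> simp at hpos
  have hcont : Continuous fun t : ℝ => chart e (m + t • v) :=
    (continuous_chart e).comp (by fun_prop)
  have hnhds := (hCc.isOpen_compl.preimage hcont).mem_nhds hmC
  obtain ⟨ε, hε, hball⟩ := Metric.mem_nhds_iff.1 hnhds
  refine ⟨ε / 2, by positivity, fun t ⟨ht0, ht⟩ => ?_⟩
  have htC : chart e (m + t • v) ∈ Cᶜ := hball (by
    rw [Metric.mem_ball, dist_zero_right, Real.norm_of_nonneg ht0.le]; linarith)
  rintro (hx | hx)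
  · exact htC (Or.inl hx)
  · obtain ⟨e', he', hx⟩ := mem_arcs.1 hx
    by_cases hne : e = e'
    · subst hne
      obtain ⟨q, hq, hqp⟩ := hx
      exact hv t ht0 (chart_injective hpe hqp ▸ hq)
    · exact htC (Or.inr (mem_biUnion (show e' ∈ {e' | e' ∈ polygonSides k ∧ e ≠ e'} from
        ⟨he', hne⟩) hx))

/-- A point of the gap escapes by moving to the point `m` on the outer edge and from there out of
`outer k`. -/
lemma escapes_of_gap {k : ℕ} (ih : ∀ x ∉ outer k, Escapes x) {e : Plane × Plane}
    (he : e ∈ polygonSides k) {G : Set (ℝ × ℝ)} (hG : Convex ℝ G)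
    (hGs : G ⊆ leftGapRef ∪ rightGapRef) {m v p : ℝ × ℝ} (hm : m ∈ G)
    (hv : ∀ t : ℝ, 0 < t → m + t • v ∉ hullRef) (hp : p ∈ G) : Escapes (chart e p) := by
  obtain ⟨ε, hε, hexit⟩ := exists_exit he (hGs hm) hv
  have hGK : chart e '' G ⊆ kochCurveᶜ := by
    rintro _ ⟨q, hq, rfl⟩ hK
    exact notMem_outer_succ_of_gap he (hGs hq) (kochCurve_subset_outer _ hK)
  refine Escapes.of_isPreconnected (convex_chart_image e hG).isPreconnected hGK
    (mem_image_of_mem _ hp) (mem_image_of_mem _ hm) ?_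
  have hcont : Continuous fun t : ℝ => chart e (m + t • v) :=
    (continuous_chart e).comp (by fun_prop)
  refine Escapes.of_isPreconnected (isPreconnected_Icc.image _ hcont.continuousOn) ?_
    ⟨0, left_mem_Icc.2 hε.le, by simp⟩ ⟨ε, right_mem_Icc.2 hε.le, rfl⟩
    (ih _ (hexit ε (right_mem_Ioc.2 hε)))
  rintro _ ⟨t, ⟨ht0, ht⟩, rfl⟩
  rcases ht0.eq_or_lt with rfl | ht0
  · exact hGK ⟨m, hm, by simp⟩
  · exact fun hK => hexit t ⟨ht0, ht⟩ (kochCurve_subset_outer _ hK)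

lemma escapes_of_notMem_outer {k : ℕ} {x : Plane} (hx : x ∉ outer k) : Escapes x := by
  induction k generalizing x with
  | zero => exact escapes_of_notMem_outer_zero hx
  | succ k ih =>
    by_cases hxk : x ∈ outer k
    · have hxa : x ∈ arcs k := hxk.resolve_left fun h => hx (Or.inl (solid_subset_succ k h))
      obtain ⟨e, he, p, hp, rfl⟩ := mem_arcs.1 hxa
      rcases hullRef_cover hp with h | h | ⟨ψ, hψ, q, hq, rfl⟩
      · -- Each gap is left through the midpoint of its edge on the boundary of the hull.
        rcases h with h | h
        · refine escapes_of_gap (fun x hx => ih hx) he convex_leftGapRef subset_union_left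
            (m := (1 / 6, 1 / 6)) (v := (-1, 1)) ?_ ?_ h
          · refine ⟨?_, ?_, ?_⟩ <;> norm_num
          · rintro t ht ⟨h1, h2, h3⟩
            simp at h2
            linarith
        · refine escapes_of_gap (fun x hx => ih hx) he convex_rightGapRef subset_union_right
            (m := (2 / 3, 1 / 6)) (v := (0, 1)) ?_ ?_ h
          · refine ⟨?_, ?_, ?_⟩ <;> norm_num
          · rintro t ht ⟨h1, h2, h3⟩
            simp at h3
            linarith
      · exact absurd (Or.inl (bump_subset_solid he ⟨p, h, rfl⟩)) hx
      · refine absurd (Or.inr (mem_arcs.2 ⟨subEdge e ψ, mem_polygonSides_succ.2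
          ⟨e, he, mem_subdivide.2 ⟨ψ, hψ, rfl⟩⟩, q, hq, chart_subEdge_of_mem hψ e q⟩)) hx
    · exact ih hxk

/-! ### Interior points -/

/-- The curve does not enter the interior of the polygonal regions: a point of a hull in that
interior would have neighbours in `solid k` and in the hull but off the base. -/
lemma interior_solid_disjoint_arcs {k : ℕ} {x : Plane} (hx : x ∈ interior (solid k)) :
    x ∉ arcs k := by
  intro hxa
  obtain ⟨e, he, p, hp, rfl⟩ := mem_arcs.1 hxa
  -- Move `p` slightly towards an interior point of the hull.
  have hcont : Continuous fun t : ℝ => chart e (p + t • ((1 / 2, 1 / 8) - p)) :=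
    (continuous_chart e).comp (by fun_prop)
  have hnhds := (isOpen_interior.preimage hcont).mem_nhds (x := 0) (by simpa using hx)
  obtain ⟨ε, hε, hball⟩ := Metric.mem_nhds_iff.1 hnhds
  set t := min (ε / 2) 1 with ht
  have ht0 : 0 < t := by positivity
  have ht1 : t ≤ 1 := min_le_right _ _
  have htε : t ≤ ε / 2 := min_le_left _ _
  have h := interior_subset (hball (show t ∈ Metric.ball 0 ε by
    rw [Metric.mem_ball, dist_zero_right, Real.norm_of_nonneg ht0.le]; linarith))
  obtain ⟨h1, h2, h3⟩ := hp
  have h4 := snd_eq_zero_of_mem_solid he (p := p + t • ((1 / 2, 1 / 8) - p))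
    ⟨by simp; nlinarith, by simp; nlinarith, by simp; nlinarith⟩ h
  simp at h4
  nlinarith

/-- The union of the interiors of the polygonal regions: the inside of the limit curve. -/
def inside : Set Plane := ⋃ k, interior (solid k)

lemma isOpen_inside : IsOpen inside := isOpen_iUnion fun _ => isOpen_interior

/-- Near a point off the limit curve the regions `solid k` are eventually constant; hence the
inside is relatively closed in the complement of the curve. -/
lemma closure_inside_subset : closure inside ∩ kochCurveᶜ ⊆ inside := by
  rintro x ⟨hx, hxK⟩
  rw [kochCurve_eq_iInter_arcs, mem_compl_iff, mem_iInter, not_forall] at hxK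
  obtain ⟨k, hk⟩ := hxK
  have hxk : x ∈ solid k := by
    rw [← (isCompact_solid k).isClosed.closure_eq]
    rw [mem_closure_iff] at hx ⊢
    intro o ho hxo
    obtain ⟨y, ⟨hyo, hya⟩, hy⟩ := hx (o ∩ (arcs k)ᶜ)
      (ho.inter (isCompact_arcs k).isClosed.isOpen_compl) ⟨hxo, hk⟩
    obtain ⟨m, hm⟩ := mem_iUnion.1 hy
    refine ⟨y, hyo, ?_⟩
    rcases le_total m k with h | h
    · exact monotone_solid h (interior_subset hm)
    · exact (antitone_outer h (Or.inl (interior_subset hm))).resolve_right hya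
  refine mem_iUnion.2 ⟨k, ?_⟩
  by_contra hxi
  refine hk (polygonCurve_subset_arcs k (frontier_solid_subset k ?_))
  rw [(isCompact_solid k).isClosed.frontier_eq]
  exact ⟨hxk, hxi⟩

lemma inside_subset_snowflake : inside ⊆ snowflake := by
  intro x hx
  have hxK : x ∈ kochCurveᶜ := fun h => by
    obtain ⟨k, hk⟩ := mem_iUnion.1 hx
    exact interior_solid_disjoint_arcs hk (kochCurve_subset_arcs k h)
  refine ⟨hxK, ?_⟩
  have hsub : connectedComponentIn kochCurveᶜ x ⊆ inside := by
    refine isPreconnected_connectedComponentIn.subset_of_closure_inter_subset isOpen_inside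
      ⟨x, mem_connectedComponentIn hxK, hx⟩ ?_
    exact (inter_subset_inter_right _ (connectedComponentIn_subset _ _)).trans
      closure_inside_subset
  refine ((isCompact_solid 0).union (isCompact_arcs 0)).isBounded.subset (hsub.trans ?_)
  refine iUnion_subset fun k => interior_subset.trans ?_
  exact subset_union_left.trans (antitone_outer (Nat.zero_le k))

/-! ### Topology of the snowflake -/

lemma snowflake_subset_outer (k : ℕ) : snowflake ⊆ outer k := fun _ hx => by
  by_contra h
  exact (escapes_of_notMem_outer h).notMem_snowflake hx

lemma isBounded_snowflake : Bornology.IsBounded snowflake :=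
  ((isCompact_solid 0).union (isCompact_arcs 0)).isBounded.subset (snowflake_subset_outer 0)

lemma connectedComponentIn_subset_snowflake {x : Plane} (hx : x ∈ snowflake) :
    connectedComponentIn kochCurveᶜ x ⊆ snowflake := fun _ hy =>
  ⟨connectedComponentIn_subset _ _ hy, connectedComponentIn_eq hy ▸ hx.2⟩

lemma isOpen_snowflake : IsOpen snowflake := by
  rw [isOpen_iff_mem_nhds]
  intro x hx
  exact mem_of_superset (isCompact_kochCurve.isClosed.isOpen_compl.connectedComponentIn.mem_nhds
    (mem_connectedComponentIn hx.1)) (connectedComponentIn_subset_snowflake hx)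

lemma frontier_snowflake_subset : frontier snowflake ⊆ kochCurve := by
  rw [isOpen_snowflake.frontier_eq]
  rintro x ⟨hx, hxS⟩
  by_contra hxK
  have ho := isCompact_kochCurve.isClosed.isOpen_compl.connectedComponentIn (x := x)
  obtain ⟨y, hy, hyS⟩ := mem_closure_iff.1 hx _ ho (mem_connectedComponentIn hxK)
  exact hxS (connectedComponentIn_subset_snowflake hyS (connectedComponentIn_eq hy ▸
    mem_connectedComponentIn hxK))

lemma exists_mem_frontier_of_mem_segment {E : Type*} [NormedAddCommGroup E] [NormedSpace ℝ E]
    {A : Set E} (hA : IsOpen A) {x y : E} (hx : x ∈ A) (hy : y ∉ A) :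
    ∃ z ∈ frontier A, dist x z ≤ dist x y := by
  by_contra! h
  refine hy ((convex_segment x y).isPreconnected.subset_of_closure_inter_subset hA
    ⟨x, left_mem_segment ℝ x y, hx⟩ ?_ (right_mem_segment ℝ x y))
  rintro z ⟨hz, hzs⟩
  by_contra hzA
  have h1 := h z (by rw [hA.frontier_eq]; exact ⟨hz, hzA⟩)
  have h2 := dist_add_dist_of_mem_segment hzs
  linarith [dist_nonneg (x := z) (y := y)]

/-! ### Balls on both sides of the curve -/

/-- A ball inside the bump erected on `e`, around its barycentre. The factor `1 / 60` is small
enough for the ball to fit. -/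
def insideBall (e : Plane × Plane) : Set Plane :=
  Metric.ball (chart e (4 / 9, 1 / 9)) (1 / 60 * ‖e.2 - e.1‖)

/-- A ball inside the left gap over `e`, around its barycentre. -/
def outsideBall (e : Plane × Plane) : Set Plane :=
  Metric.ball (chart e (2 / 9, 1 / 9)) (1 / 60 * ‖e.2 - e.1‖)

/-- The union of the balls inside the bumps erected on the sides of the `k`-th polygon. -/
def insideBalls (k : ℕ) : Set Plane := ⋃ e ∈ polygonSides k, insideBall e

lemma exists_of_mem_insideBall {k : ℕ} {e : Plane × Plane} (he : e ∈ polygonSides k) {x : Plane}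
    (hx : x ∈ insideBall e) :
    ∃ p : ℝ × ℝ, chart e p = x ∧ 0 < p.2 ∧ 1 / 3 < p.1 ∧ p.1 + p.2 < 2 / 3 := by
  obtain ⟨p, hp, h1, h2⟩ :=
    exists_chart_eq_of_mem_ball (norm_polygonSides_pos he) (by norm_num) hx
  rw [abs_lt] at h1 h2
  dsimp only at h1 h2
  exact ⟨p, hp, by linarith, by linarith, by linarith⟩

lemma exists_of_mem_outsideBall {k : ℕ} {e : Plane × Plane} (he : e ∈ polygonSides k) {x : Plane}
    (hx : x ∈ outsideBall e) : ∃ p ∈ leftGapRef, chart e p = x := by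
  obtain ⟨p, hp, h1, h2⟩ :=
    exists_chart_eq_of_mem_ball (norm_polygonSides_pos he) (by norm_num) hx
  rw [abs_lt] at h1 h2
  dsimp only at h1 h2
  exact ⟨p, ⟨by linarith, by linarith, by linarith⟩, hp⟩

lemma insideBall_subset_hull {k : ℕ} {e : Plane × Plane} (he : e ∈ polygonSides k) :
    insideBall e ⊆ hull e := by
  intro x hx
  obtain ⟨p, rfl, h1, h2, h3⟩ := exists_of_mem_insideBall he hx
  exact ⟨p, ⟨by linarith, by linarith, by linarith⟩, rfl⟩

lemma outsideBall_subset_hull {k : ℕ} {e : Plane × Plane} (he : e ∈ polygonSides k) :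
    outsideBall e ⊆ hull e := by
  intro x hx
  obtain ⟨p, hp, rfl⟩ := exists_of_mem_outsideBall he hx
  exact ⟨p, (gapRef_spec (Or.inl hp)).1, rfl⟩

lemma insideBall_subset_snowflake {k : ℕ} {e : Plane × Plane} (he : e ∈ polygonSides k) :
    insideBall e ⊆ snowflake := by
  intro x hx
  obtain ⟨p, rfl, h1, h2, h3⟩ := exists_of_mem_insideBall he hx
  exact inside_subset_snowflake (mem_iUnion.2 ⟨k + 1,
    mem_interior_solid_succ he h2 h3 (by linarith) (by linarith)⟩)

lemma outsideBall_subset_compl {k : ℕ} {e : Plane × Plane} (he : e ∈ polygonSides k) :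
    outsideBall e ⊆ snowflakeᶜ := by
  intro x hx
  obtain ⟨p, hp, rfl⟩ := exists_of_mem_outsideBall he hx
  exact fun h => notMem_outer_succ_of_gap he (Or.inl hp) (snowflake_subset_outer (k + 1) h)

lemma insideBall_disjoint_solid {k : ℕ} {e : Plane × Plane} (he : e ∈ polygonSides k) :
    Disjoint (insideBall e) (solid k) := by
  rw [Set.disjoint_left]
  intro x hx hs
  obtain ⟨p, rfl, h1, h2, h3⟩ := exists_of_mem_insideBall he hx
  exact h1.ne' (snd_eq_zero_of_mem_solid he ⟨by linarith, by linarith, by linarith⟩ hs)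

lemma insideBall_subset_solid {k : ℕ} {e : Plane × Plane} (he : e ∈ polygonSides k) :
    insideBall e ⊆ solid (k + 1) := by
  intro x hx
  obtain ⟨p, rfl, h1, h2, h3⟩ := exists_of_mem_insideBall he hx
  exact interior_subset (mem_interior_solid_succ he h2 h3 (by linarith) (by linarith))

lemma dist_le_of_mem_balls {k : ℕ} {e : Plane × Plane} (he : e ∈ polygonSides k) {x y : Plane}
    (hx : x ∈ insideBall e) (hy : y ∈ outsideBall e) : dist x y ≤ (1 / 3) ^ k := by
  rw [← norm_polygonSides he]
  have h : dist (chart e (4 / 9, 1 / 9)) (chart e (2 / 9, 1 / 9)) = 2 / 9 * ‖e.2 - e.1‖ := by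
    rw [dist_eq_norm, ← sq_eq_sq₀ (norm_nonneg _) (by positivity), norm_chart_sub_sq]
    ring
  have h1 := Metric.mem_ball.1 hx
  have h2 := Metric.mem_ball'.1 hy
  have h3 := dist_triangle4 x (chart e (4 / 9, 1 / 9)) (chart e (2 / 9, 1 / 9)) y
  linarith [norm_nonneg (e.2 - e.1)]

lemma measurableSet_insideBalls (k : ℕ) : MeasurableSet (insideBalls k) :=
  (isOpen_biUnion fun _ _ => Metric.isOpen_ball).measurableSet

lemma pairwise_disjoint_insideBalls : Pairwise (Function.onFun Disjoint insideBalls) := by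
  have key : ∀ i j, i < j → Disjoint (insideBalls i) (insideBalls j) := by
    intro i j hij
    rw [Set.disjoint_left]
    intro x hx hx'
    simp only [insideBalls, mem_iUnion] at hx hx'
    obtain ⟨e, he, hx⟩ := hx
    obtain ⟨e', he', hx'⟩ := hx'
    exact Set.disjoint_left.1 (insideBall_disjoint_solid he') hx'
      (monotone_solid (Nat.succ_le_of_lt hij) (insideBall_subset_solid he hx))
  intro i j hij
  rcases hij.lt_or_gt with h | h
  · exact key i j h
  · exact (key j i h).symm

lemma measure_biUnion_list_eq {α ι : Type*} [MeasurableSpace α] {μ : Measure α} {l : List ι}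
    {f : ι → Set α} {c : ENNReal} (hm : ∀ i ∈ l, MeasurableSet (f i))
    (hd : l.Pairwise fun i j => Disjoint (f i) (f j)) (hc : ∀ i ∈ l, μ (f i) = c) :
    μ (⋃ i ∈ l, f i) = l.length * c := by
  induction l with
  | nil => simp
  | cons a l ih =>
    rw [List.pairwise_cons] at hd
    simp only [List.mem_cons, forall_eq_or_imp] at hm hc
    simp only [List.mem_cons, iUnion_iUnion_eq_or_left, List.length_cons]
    rw [measure_union, ih hm.2 hd.2 hc.2, hc.1]
    · push_cast; ring
    · exact disjoint_iUnion₂_right.2 hd.1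
    · exact l.finite_toSet.measurableSet_biUnion hm.2

lemma measure_biUnion_list_le {α ι : Type*} [MeasurableSpace α] {μ : Measure α} {l : List ι}
    {f : ι → Set α} {c : ENNReal} (hc : ∀ i ∈ l, μ (f i) ≤ c) :
    μ (⋃ i ∈ l, f i) ≤ l.length * c := by
  induction l with
  | nil => simp
  | cons a l ih =>
    simp only [List.mem_cons, forall_eq_or_imp] at hc
    simp only [List.mem_cons, iUnion_iUnion_eq_or_left, List.length_cons]
    refine (measure_union_le _ _).trans ((add_le_add hc.1 (ih hc.2)).trans_eq ?_)
    push_cast; ring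

/-- The area of the unit disc. -/
noncomputable def discArea : ENNReal := volume (Metric.ball (0 : Plane) 1)

lemma discArea_ne_zero : discArea ≠ 0 := (Metric.measure_ball_pos _ _ one_pos).ne'

lemma discArea_ne_top : discArea ≠ ⊤ := measure_ball_lt_top.ne

lemma volume_ball_eq (x : Plane) {r : ℝ} (hr : 0 ≤ r) :
    volume (Metric.ball x r) = ENNReal.ofReal (r ^ 2) * discArea := by
  rw [Measure.addHaar_ball _ _ hr, discArea]; simp

lemma volume_closedBall_eq (x : Plane) {r : ℝ} (hr : 0 ≤ r) :
    volume (Metric.closedBall x r) = ENNReal.ofReal (r ^ 2) * discArea := by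
  rw [Measure.addHaar_closedBall _ _ hr, discArea]; simp

lemma volume_outsideBall {k : ℕ} {e : Plane × Plane} (he : e ∈ polygonSides k) :
    volume (outsideBall e) = ENNReal.ofReal ((1 / 60 * (1 / 3) ^ k) ^ 2) * discArea := by
  rw [outsideBall, volume_ball_eq _ (by positivity), norm_polygonSides he]

lemma natCast_mul_ofReal (n : ℕ) {r : ℝ} : (n : ENNReal) * ENNReal.ofReal r =
    ENNReal.ofReal (n * r) := by
  rw [ENNReal.ofReal_mul (by positivity), ENNReal.ofReal_natCast]

lemma volume_insideBalls (k : ℕ) :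
    volume (insideBalls k) = ENNReal.ofReal (1 / 1200 * (4 / 9) ^ k) * discArea := by
  rw [insideBalls, measure_biUnion_list_eq (f := insideBall)
    (fun _ _ => Metric.isOpen_ball.measurableSet) ?_
    (c := ENNReal.ofReal ((1 / 60 * (1 / 3) ^ k) ^ 2) * discArea) ?_, length_polygonSides,
    ← mul_assoc, natCast_mul_ofReal]
  · congr 2
    push_cast
    rw [show (4 / 9 : ℝ) = 4 * (1 / 3) ^ 2 by norm_num, mul_pow, ← pow_mul, mul_pow, ← pow_mul]
    ring
  · refine (pairwise_polygonSides k).imp_of_mem fun {e e'} he he' h => ?_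
    rw [Set.disjoint_left]
    intro x hx hx'
    have hend := (h x (insideBall_subset_hull he hx) (insideBall_subset_hull he' hx')).1
    obtain ⟨p, rfl, h1, h2, h3⟩ := exists_of_mem_insideBall he hx
    rcases isEnd_of_chart (norm_polygonSides_pos he) hend with rfl | rfl <;> simp at h1
  · intro e he
    rw [insideBall, volume_ball_eq _ (by positivity), norm_polygonSides he]

/-! ### Areas of neighbourhoods -/

lemma cthickening_kochCurve_subset (k : ℕ) : Metric.cthickening ((1 / 3) ^ k) kochCurve ⊆
    ⋃ e ∈ polygonSides k, Metric.closedBall e.1 (2 * (1 / 3) ^ k) := by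
  rw [isCompact_kochCurve.cthickening_eq_biUnion_closedBall (by positivity)]
  refine iUnion₂_subset fun z hz x hx => ?_
  obtain ⟨e, he, hze⟩ := mem_arcs.1 (kochCurve_subset_arcs k hz)
  refine mem_biUnion (show e ∈ {e | e ∈ polygonSides k} from he) ?_
  have h1 := dist_fst_le_of_mem_hull hze
  rw [norm_polygonSides he] at h1
  have h2 := dist_triangle x z e.1
  rw [Metric.mem_closedBall] at hx ⊢
  linarith

lemma volume_cthickening_kochCurve_le (k : ℕ) :
    volume (Metric.cthickening ((1 / 3) ^ k) kochCurve) ≤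
      ENNReal.ofReal (12 * (4 / 9) ^ k) * discArea := by
  refine (measure_mono (cthickening_kochCurve_subset k)).trans
    ((measure_biUnion_list_le fun e _ => (volume_closedBall_eq _ (by positivity)).le).trans_eq ?_)
  rw [length_polygonSides, ← mul_assoc, natCast_mul_ofReal]
  congr 2
  push_cast
  rw [show (4 / 9 : ℝ) = 4 * (1 / 3) ^ 2 by norm_num, mul_pow, ← pow_mul, mul_pow, ← pow_mul]
  ring

lemma insideBalls_subset_cthickening (k : ℕ) :
    insideBalls k ⊆ Metric.cthickening ((1 / 3) ^ k) (frontier snowflake) := by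
  refine iUnion₂_subset fun e he x hx => ?_
  have hy : chart e (2 / 9, 1 / 9) ∈ outsideBall e :=
    Metric.mem_ball_self (mul_pos (by norm_num) (norm_polygonSides_pos he))
  obtain ⟨z, hz, h⟩ := exists_mem_frontier_of_mem_segment isOpen_snowflake
    (insideBall_subset_snowflake he hx) (outsideBall_subset_compl he hy)
  exact Metric.mem_cthickening_of_dist_le x z _ _ hz (h.trans (dist_le_of_mem_balls he hx hy))

/-- Every ball around a boundary point meets the open set `snowflake` in positive measure and
contains an outside ball. -/
lemma measureBoundary_snowflake : measureBoundary snowflake = frontier snowflake := by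
  ext x
  constructor
  · intro hx
    rw [frontier_eq_closure_inter_closure, mem_inter_iff, Metric.mem_closure_iff,
      Metric.mem_closure_iff]
    refine ⟨fun r hr => ?_, fun r hr => ?_⟩
    · obtain ⟨y, hy, hyx⟩ := nonempty_of_measure_ne_zero (hx r hr).1.ne'
      exact ⟨y, hy, Metric.mem_ball'.1 hyx⟩
    · by_contra! h
      refine (hx r hr).2.ne ?_
      rw [inter_eq_right.2]
      intro y hy
      by_contra hyS
      exact absurd (Metric.mem_ball'.1 hy) (h y hyS).not_gt
  · intro hx r hr
    have hxK := frontier_snowflake_subset hx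
    constructor
    · have ho := isOpen_snowflake.inter (Metric.isOpen_ball (x := x) (ε := r))
      refine ho.measure_pos volume ?_
      obtain ⟨y, hy, hyx⟩ := Metric.mem_closure_iff.1 (frontier_subset_closure hx) r hr
      exact ⟨y, hy, Metric.mem_ball'.2 hyx⟩
    · obtain ⟨k, hk⟩ := exists_pow_lt_of_lt_one (show 0 < r / 2 by positivity)
        (show (1 / 3 : ℝ) < 1 by norm_num)
      obtain ⟨e, he, hxe⟩ := mem_arcs.1 (kochCurve_subset_arcs k hxK)
      have hsub : outsideBall e ⊆ Metric.ball x r := by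
        intro y hy
        have h1 := dist_fst_le_of_mem_hull (outsideBall_subset_hull he hy)
        have h2 := dist_fst_le_of_mem_hull hxe
        rw [norm_polygonSides he] at h1 h2
        rw [Metric.mem_ball]
        linarith [dist_triangle_right y x e.1]
      have hpos : volume (outsideBall e) ≠ 0 := (Metric.measure_ball_pos _ _
        (mul_pos (by norm_num) (norm_polygonSides_pos he))).ne'
      calc volume (snowflake ∩ Metric.ball x r)
          ≤ volume (Metric.ball x r \ outsideBall e) := by
            refine measure_mono fun y hy => ⟨hy.2, fun h => ?_⟩
            exact outsideBall_subset_compl he h hy.1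
        _ = volume (Metric.ball x r) - volume (outsideBall e) :=
            measure_sdiff hsub Metric.isOpen_ball.measurableSet.nullMeasurableSet
              measure_ball_lt_top.ne
        _ < volume (Metric.ball x r) :=
            ENNReal.sub_lt_self measure_ball_lt_top.ne (Metric.measure_ball_pos _ _ hr).ne' hpos

/-! ### The critical exponent -/

/-- The codimension `2 - log 4 / log 3` of the Koch curve. -/
noncomputable def codim : ℝ := 2 - Real.log 4 / Real.log 3

lemma one_third_rpow_codim : (1 / 3 : ℝ) ^ codim = 4 / 9 := by
  have h3 : Real.log 3 ≠ 0 := (Real.log_pos (by norm_num)).ne'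
  rw [Real.rpow_def_of_pos (by norm_num), codim, one_div, Real.log_inv,
    show -Real.log 3 * (2 - Real.log 4 / Real.log 3) = Real.log 4 - 2 * Real.log 3 by
      field_simp; ring, Real.exp_sub, mul_comm (2 : ℝ), Real.exp_mul, Real.exp_log (by norm_num),
    Real.exp_log (by norm_num)]
  norm_num

lemma codim_pos : 0 < codim := by
  by_contra! h
  have := Real.one_le_rpow_of_pos_of_le_one_of_nonpos (x := 1 / 3) (by norm_num) (by norm_num) h
  rw [one_third_rpow_codim] at this
  norm_num at this

lemma codim_lt_one : codim < 1 := by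
  by_contra! h
  have := Real.rpow_le_rpow_of_exponent_ge (x := 1 / 3) (by norm_num) (by norm_num) h
  rw [one_third_rpow_codim] at this
  norm_num at this

lemma one_third_pow_rpow (k : ℕ) (s : ℝ) :
    ((1 / 3 : ℝ) ^ k) ^ (((2 : ℕ) : ℝ) + s) = ((1 / 3) ^ k) ^ 2 * ((1 / 3) ^ s) ^ k := by
  rw [Real.rpow_add (by positivity), Real.rpow_natCast, Real.rpow_pow_comm (by norm_num)]

/-! ### The fractional perimeter -/

/-- The kernel of the fractional perimeter in the plane. -/
noncomputable def kernel (s : ℝ) (x y : Plane) : ENNReal :=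
  ENNReal.ofReal (1 / ‖x - y‖ ^ (((2 : ℕ) : ℝ) + s))

lemma fracPerimeter_eq (s : ℝ) :
    fracPerimeter s snowflake = ∫⁻ x in snowflake, ∫⁻ y in snowflakeᶜ, kernel s x y := by
  simp [fracPerimeter, fracPerimeterIn, interaction, kernel]

lemma localFracPerimeter_eq (s : ℝ) :
    localFracPerimeter s snowflake univ = fracPerimeter s snowflake := by
  rw [fracPerimeter_eq]
  simp [localFracPerimeter, interaction, kernel]

lemma ofReal_le_kernel {s : ℝ} (hs : 0 < s) {x y : Plane} (hxy : x ≠ y) {r : ℝ}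
    (h : dist x y ≤ r) : ENNReal.ofReal (1 / r ^ (((2 : ℕ) : ℝ) + s)) ≤ kernel s x y := by
  rw [dist_eq_norm] at h
  have hpos : 0 < ‖x - y‖ := norm_pos_iff.2 (sub_ne_zero.2 hxy)
  refine ENNReal.ofReal_le_ofReal (one_div_le_one_div_of_le (by positivity) ?_)
  exact Real.rpow_le_rpow hpos.le h (by positivity)

lemma kernel_le_ofReal {s : ℝ} (hs : 0 < s) {x y : Plane} {r : ℝ} (hr : 0 < r)
    (h : r ≤ dist x y) : kernel s x y ≤ ENNReal.ofReal (1 / r ^ (((2 : ℕ) : ℝ) + s)) := by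
  rw [dist_eq_norm] at h
  refine ENNReal.ofReal_le_ofReal (one_div_le_one_div_of_le (by positivity) ?_)
  exact Real.rpow_le_rpow hr.le h (by positivity)

/-- All generations of bumps contribute at least a fixed amount to the fractional perimeter once
`s` is at least the codimension. -/
lemma fracPerimeter_eq_top {s : ℝ} (hs : codim ≤ s) : fracPerimeter s snowflake = ⊤ := by
  have hs0 : 0 < s := codim_pos.trans_le hs
  set q : ℝ := (1 / 3) ^ s with hq
  have hq0 : 0 < q := by positivity
  have hq1 : q ≤ 4 / 9 := by
    rw [← one_third_rpow_codim]
    exact Real.rpow_le_rpow_of_exponent_ge (by norm_num) (by norm_num) hs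
  have hinner : ∀ k, ∀ x ∈ insideBalls k,
      ENNReal.ofReal (1 / (3600 * q ^ k)) * discArea ≤ ∫⁻ y in snowflakeᶜ, kernel s x y := by
    intro k x hx
    simp only [insideBalls, mem_iUnion] at hx
    obtain ⟨e, he, hx⟩ := hx
    calc ENNReal.ofReal (1 / (3600 * q ^ k)) * discArea
        = ENNReal.ofReal (1 / ((1 / 3) ^ k) ^ (((2 : ℕ) : ℝ) + s)) * volume (outsideBall e) := by
          rw [volume_outsideBall he, ← mul_assoc, ← ENNReal.ofReal_mul (by positivity),
            one_third_pow_rpow]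
          congr 2
          rw [← hq]
          field_simp
          norm_num
      _ = ∫⁻ y in outsideBall e, ENNReal.ofReal (1 / ((1 / 3) ^ k) ^ (((2 : ℕ) : ℝ) + s)) :=
          (setLIntegral_const _ _).symm
      _ ≤ ∫⁻ y in outsideBall e, kernel s x y := by
          refine setLIntegral_mono' Metric.isOpen_ball.measurableSet fun y hy => ?_
          -- The points are distinct, so the value of the kernel on the diagonal is irrelevant.
          refine ofReal_le_kernel hs0 ?_ (dist_le_of_mem_balls he hx hy)
          rintro rfl
          exact outsideBall_subset_compl he hy (insideBall_subset_snowflake he hx)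
      _ ≤ ∫⁻ y in snowflakeᶜ, kernel s x y := lintegral_mono_set (outsideBall_subset_compl he)
  have hlevel : ∀ k, ENNReal.ofReal (1 / 4320000) * discArea ^ 2 ≤
      ∫⁻ x in insideBalls k, ∫⁻ y in snowflakeᶜ, kernel s x y := by
    intro k
    refine le_trans ?_ (setLIntegral_mono' (measurableSet_insideBalls k) (hinner k))
    rw [setLIntegral_const, volume_insideBalls, mul_mul_mul_comm, ← pow_two,
      ← ENNReal.ofReal_mul (by positivity)]
    gcongr
    have h : q ^ k ≤ (4 / 9) ^ k := by gcongr
    rw [div_mul_eq_mul_div, one_mul, le_div_iff₀ (by positivity)]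
    linarith
  have hsub : ⋃ k, insideBalls k ⊆ snowflake :=
    iUnion_subset fun k => iUnion₂_subset fun e he => insideBall_subset_snowflake he
  rw [fracPerimeter_eq, eq_top_iff]
  calc ⊤ = ∑' _ : ℕ, ENNReal.ofReal (1 / 4320000) * discArea ^ 2 := by
        refine (ENNReal.tsum_const_eq_top_of_ne_zero (mul_ne_zero ?_ ?_)).symm
        · simp
        · exact pow_ne_zero _ discArea_ne_zero
    _ ≤ ∑' k, ∫⁻ x in insideBalls k, ∫⁻ y in snowflakeᶜ, kernel s x y :=
        ENNReal.tsum_le_tsum hlevel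
    _ = ∫⁻ x in ⋃ k, insideBalls k, ∫⁻ y in snowflakeᶜ, kernel s x y :=
        (lintegral_iUnion measurableSet_insideBalls pairwise_disjoint_insideBalls _).symm
    _ ≤ _ := lintegral_mono_set hsub

/-- An integrable majorant of the kernel away from the diagonal. -/
noncomputable def farKernel (s : ℝ) (z : Plane) : ENNReal :=
  ENNReal.ofReal (2 ^ (2 + s)) * ENNReal.ofReal ((1 + ‖z‖) ^ (-(2 + s)))

lemma measurable_farKernel (s : ℝ) : Measurable (farKernel s) := by
  unfold farKernel; fun_prop

lemma lintegral_farKernel_lt_top {s : ℝ} (hs : 0 < s) : ∫⁻ z, farKernel s z < ⊤ := by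
  unfold farKernel
  rw [lintegral_const_mul' _ _ ENNReal.ofReal_ne_top]
  refine ENNReal.mul_lt_top ENNReal.ofReal_lt_top (finite_integral_one_add_norm ?_)
  simpa using hs

lemma kernel_le_farKernel {s : ℝ} (hs : 0 < s) {x y : Plane} (h : 1 < dist x y) :
    kernel s x y ≤ farKernel s (x - y) := by
  rw [dist_eq_norm] at h
  rw [kernel, farKernel, ← ENNReal.ofReal_mul (by positivity)]
  refine ENNReal.ofReal_le_ofReal ?_
  rw [Real.rpow_neg (by positivity), ← div_eq_mul_inv, Nat.cast_ofNat,
    div_le_div_iff₀ (by positivity) (by positivity), one_mul,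
    ← Real.mul_rpow (by norm_num) (by positivity)]
  exact Real.rpow_le_rpow (by positivity) (by linarith) (by positivity)

/-- The dyadic majorant: a pair of points on different sides of the curve at distance about
`3⁻ʲ` lies in the `3⁻ʲ`-neighbourhood of the curve. -/
lemma kernel_le_tsum {s : ℝ} (hs : 0 < s) {x y : Plane} (hx : x ∈ snowflake)
    (hy : y ∉ snowflake) :
    kernel s x y ≤ farKernel s (x - y) +
      ∑' j : ℕ, ENNReal.ofReal (1 / ((1 / 3) ^ (j + 1)) ^ (((2 : ℕ) : ℝ) + s)) *
        (Metric.cthickening ((1 / 3) ^ j) kochCurve).indicator 1 x *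
        (Metric.closedBall x ((1 / 3) ^ j)).indicator 1 y := by
  rcases lt_or_ge 1 (dist x y) with h | h
  · exact (kernel_le_farKernel hs h).trans le_self_add
  · have hxy : x ≠ y := by rintro rfl; exact hy hx
    obtain ⟨j, hj1, hj2⟩ := exists_nat_pow_near_of_lt_one (dist_pos.2 hxy) h
      (show (0 : ℝ) < 1 / 3 by norm_num) (by norm_num)
    refine le_trans ?_ (le_add_of_nonneg_left zero_le)
    refine le_trans ?_ (ENNReal.le_tsum j)
    obtain ⟨z, hz, hxz⟩ := exists_mem_frontier_of_mem_segment isOpen_snowflake hx hy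
    have h1 : x ∈ Metric.cthickening ((1 / 3) ^ j) kochCurve :=
      Metric.mem_cthickening_of_dist_le x z _ _ (frontier_snowflake_subset hz) (hxz.trans hj2)
    have h2 : y ∈ Metric.closedBall x ((1 / 3) ^ j) := Metric.mem_closedBall'.2 hj2
    rw [indicator_of_mem h1, indicator_of_mem h2, Pi.one_apply, Pi.one_apply, mul_one, mul_one]
    exact kernel_le_ofReal hs (by positivity) hj1.le

/-- Integrating the dyadic majorant gives a geometric series of ratio `(4 / 9) * 3 ^ s`, which
converges below the codimension. -/
lemma fracPerimeter_lt_top {s : ℝ} (hs0 : 0 < s) (hs : s < codim) :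
    fracPerimeter s snowflake < ⊤ := by
  set q : ℝ := (1 / 3) ^ s with hq
  have hq0 : 0 < q := by positivity
  have hq1 : 4 / 9 < q := by
    rw [← one_third_rpow_codim]
    exact Real.rpow_lt_rpow_of_exponent_gt (by norm_num) (by norm_num) hs
  set N : ℕ → Set Plane := fun j => Metric.cthickening ((1 / 3) ^ j) kochCurve with hN
  have hNm : ∀ j, MeasurableSet (N j) := fun j => Metric.isClosed_cthickening.measurableSet
  set c : ℕ → ENNReal := fun j =>
    ENNReal.ofReal (1 / ((1 / 3) ^ (j + 1)) ^ (((2 : ℕ) : ℝ) + s)) with hc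
  set w : ℕ → ENNReal := fun j => c j * (ENNReal.ofReal (((1 / 3) ^ j) ^ 2) * discArea) with hw
  have hinner : ∀ x ∈ snowflake, ∫⁻ y in snowflakeᶜ, kernel s x y ≤
      (∫⁻ z, farKernel s z) + ∑' j, w j * (N j).indicator 1 x := by
    intro x hx
    calc ∫⁻ y in snowflakeᶜ, kernel s x y
        ≤ ∫⁻ y in snowflakeᶜ, (farKernel s (x - y) + ∑' j, c j * (N j).indicator 1 x *
            (Metric.closedBall x ((1 / 3) ^ j)).indicator 1 y) :=
          setLIntegral_mono' isOpen_snowflake.measurableSet.compl fun y hy =>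
            kernel_le_tsum hs0 hx hy
      _ ≤ ∫⁻ y, (farKernel s (x - y) + ∑' j, c j * (N j).indicator 1 x *
            (Metric.closedBall x ((1 / 3) ^ j)).indicator 1 y) := setLIntegral_le_lintegral _ _
      _ = (∫⁻ z, farKernel s z) + ∑' j, ∫⁻ y, c j * (N j).indicator 1 x *
            (Metric.closedBall x ((1 / 3) ^ j)).indicator 1 y := by
          have hm : Measurable fun y => farKernel s (x - y) :=
            (measurable_farKernel s).comp (by fun_prop)
          rw [lintegral_add_left hm,
            lintegral_sub_left_eq_self (farKernel s) x, lintegral_tsum fun j =>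
              ((measurable_one.indicator
                Metric.isClosed_closedBall.measurableSet).const_mul _).aemeasurable]
      _ = _ := by
          congr 2
          ext1 j
          rw [lintegral_const_mul _ (measurable_one.indicator
            Metric.isClosed_closedBall.measurableSet), lintegral_indicator_one
            Metric.isClosed_closedBall.measurableSet, volume_closedBall_eq _ (by positivity), hw]
          ring
  have hterm : ∀ j, w j * volume (N j) ≤
      ENNReal.ofReal (108 / q * (4 / 9 / q) ^ j) * discArea ^ 2 := by
    intro j
    refine (mul_le_mul_right (volume_cthickening_kochCurve_le j) _).trans_eq ?_
    have h : 1 / ((1 / 3) ^ (j + 1)) ^ (((2 : ℕ) : ℝ) + s) * ((1 / 3) ^ j) ^ 2 *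
        (12 * (4 / 9) ^ j) = 108 / q * (4 / 9 / q) ^ j := by
      rw [one_third_pow_rpow, ← hq, pow_succ, pow_succ, div_pow (4 / 9) q]
      field_simp
      ring
    rw [← h, ENNReal.ofReal_mul (q := 12 * (4 / 9) ^ j) (by positivity),
      ENNReal.ofReal_mul (q := ((1 / 3) ^ j) ^ 2) (by positivity)]
    simp only [hw, hc]
    ring
  have hsum : ∑' j, w j * volume (N j) < ⊤ := by
    refine (ENNReal.tsum_le_tsum hterm).trans_lt ?_
    rw [ENNReal.tsum_mul_right]
    have hr : 4 / 9 / q < 1 := (div_lt_one hq0).2 hq1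
    rw [← ENNReal.ofReal_tsum_of_nonneg (fun j => by positivity)
      ((summable_geometric_of_lt_one (by positivity) hr).mul_left _)]
    exact ENNReal.mul_lt_top ENNReal.ofReal_lt_top
      (ENNReal.pow_lt_top discArea_ne_top.lt_top)
  rw [fracPerimeter_eq]
  calc ∫⁻ x in snowflake, ∫⁻ y in snowflakeᶜ, kernel s x y
      ≤ ∫⁻ x in snowflake, ((∫⁻ z, farKernel s z) + ∑' j, w j * (N j).indicator 1 x) :=
        setLIntegral_mono' isOpen_snowflake.measurableSet hinner
    _ = (∫⁻ z, farKernel s z) * volume snowflake +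
          ∫⁻ x in snowflake, ∑' j, w j * (N j).indicator 1 x := by
        rw [lintegral_add_left measurable_const, setLIntegral_const]
    _ ≤ (∫⁻ z, farKernel s z) * volume snowflake +
          ∫⁻ x, ∑' j, w j * (N j).indicator 1 x := by
        exact add_le_add_right (setLIntegral_le_lintegral _ _) _
    _ = (∫⁻ z, farKernel s z) * volume snowflake + ∑' j, w j * volume (N j) := by
        rw [lintegral_tsum fun j => ((measurable_one.indicator (hNm j)).const_mul _).aemeasurable]
        congr 2
        ext1 j
        rw [lintegral_const_mul _ (measurable_one.indicator (hNm j)),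
          lintegral_indicator_one (hNm j)]
    _ < ⊤ := ENNReal.add_lt_top.2 ⟨ENNReal.mul_lt_top (lintegral_farKernel_lt_top hs0)
        isBounded_snowflake.measure_lt_top, hsum⟩

lemma fracDim_snowflake : fracDim snowflake univ = 2 - codim := by
  have h : {s : ℝ | s ∈ Ioo (0 : ℝ) 1 ∧ localFracPerimeter s snowflake univ < ⊤} =
      Ioo 0 codim := by
    ext s
    rw [mem_ofPred_eq, localFracPerimeter_eq]
    constructor
    · rintro ⟨⟨h0, h1⟩, h⟩
      refine ⟨h0, ?_⟩
      by_contra! hs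
      exact h.ne (fracPerimeter_eq_top hs)
    · rintro ⟨h0, h1⟩
      exact ⟨⟨h0, h1.trans codim_lt_one⟩, fracPerimeter_lt_top h0 h1⟩
  rw [fracDim, h, csSup_Ioo codim_pos]
  norm_num

/-! ### The Minkowski dimension -/

lemma one_third_pow_rpow_codim (k : ℕ) : ((1 / 3 : ℝ) ^ k) ^ codim = (4 / 9) ^ k := by
  rw [← Real.rpow_pow_comm (by norm_num), one_third_rpow_codim]

lemma volume_cthickening_frontier_le {ρ : ℝ} (h0 : 0 < ρ) (h1 : ρ ≤ 1) :
    volume (Metric.cthickening ρ (frontier snowflake)) ≤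
      ENNReal.ofReal (27 * ρ ^ codim) * discArea := by
  obtain ⟨j, hj1, hj2⟩ := exists_nat_pow_near_of_lt_one h0 h1
      (show (0 : ℝ) < 1 / 3 by norm_num) (by norm_num)
  have h2 : (4 / 9 : ℝ) ^ (j + 1) ≤ ρ ^ codim := by
    rw [← one_third_pow_rpow_codim]
    exact Real.rpow_le_rpow (by positivity) hj1.le codim_pos.le
  refine (measure_mono ((Metric.cthickening_mono hj2 _).trans
    (Metric.cthickening_subset_of_subset _ frontier_snowflake_subset))).trans
    ((volume_cthickening_kochCurve_le j).trans ?_)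
  refine mul_le_mul_left (ENNReal.ofReal_le_ofReal ?_) _
  rw [pow_succ] at h2
  linarith

lemma le_volume_cthickening_frontier {ρ : ℝ} (h0 : 0 < ρ) (h1 : ρ ≤ 1) :
    ENNReal.ofReal (1 / 2700 * ρ ^ codim) * discArea ≤
      volume (Metric.cthickening ρ (frontier snowflake)) := by
  obtain ⟨j, hj1, hj2⟩ := exists_nat_pow_near_of_lt_one h0 h1
      (show (0 : ℝ) < 1 / 3 by norm_num) (by norm_num)
  have h2 : ρ ^ codim ≤ (4 / 9 : ℝ) ^ j := by
    rw [← one_third_pow_rpow_codim]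
    exact Real.rpow_le_rpow h0.le hj2 codim_pos.le
  refine le_trans ?_ (measure_mono ((insideBalls_subset_cthickening (j + 1)).trans
    (Metric.cthickening_mono hj1.le _)))
  rw [volume_insideBalls]
  refine mul_le_mul_left (ENNReal.ofReal_le_ofReal ?_) _
  rw [pow_succ]
  linarith

/-- The normalized area of the `ρ`-neighbourhood of the boundary, with exponent `t`. -/
noncomputable def tubeRatio (t ρ : ℝ) : ENNReal :=
  volume (Metric.cthickening ρ (frontier snowflake) ∩ univ) / ENNReal.ofReal (ρ ^ t)

lemma tubeRatio_le {t ρ : ℝ} (h0 : 0 < ρ) (h1 : ρ ≤ 1) :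
    tubeRatio t ρ ≤ ENNReal.ofReal (27 * ρ ^ (codim - t)) * discArea := by
  have hpos : 0 < ρ ^ t := by positivity
  rw [tubeRatio, inter_univ]
  refine ENNReal.div_le_of_le_mul ((volume_cthickening_frontier_le h0 h1).trans_eq ?_)
  rw [mul_right_comm, ← ENNReal.ofReal_mul (by positivity), Real.rpow_sub h0]
  congr 2
  field_simp

lemma le_tubeRatio {t ρ : ℝ} (h0 : 0 < ρ) (h1 : ρ ≤ 1) :
    ENNReal.ofReal (1 / 2700 * ρ ^ (codim - t)) * discArea ≤ tubeRatio t ρ := by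
  have hpos : 0 < ρ ^ t := by positivity
  rw [tubeRatio, inter_univ, ENNReal.le_div_iff_mul_le (Or.inl (by simpa using hpos))
    (Or.inl ENNReal.ofReal_ne_top)]
  refine le_trans (le_of_eq ?_) (le_volume_cthickening_frontier h0 h1)
  rw [mul_right_comm, ← ENNReal.ofReal_mul (by positivity), Real.rpow_sub h0]
  congr 2
  field_simp

lemma eventually_small : ∀ᶠ ρ : ℝ in 𝓝[>] 0, 0 < ρ ∧ ρ ≤ 1 := by
  filter_upwards [Ioc_mem_nhdsGT (zero_lt_one' ℝ)] with ρ hρ using hρ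

lemma liminf_tubeRatio_eq_zero_iff {t : ℝ} :
    liminf (tubeRatio t) (𝓝[>] 0) = 0 ↔ t < codim := by
  constructor
  · intro h
    by_contra! ht
    have hle : ENNReal.ofReal (1 / 2700) * discArea ≤ liminf (tubeRatio t) (𝓝[>] 0) := by
      refine le_liminf_of_le (by isBoundedDefault) ?_
      filter_upwards [eventually_small] with ρ ⟨h0, h1⟩
      refine le_trans ?_ (le_tubeRatio h0 h1)
      gcongr
      have := Real.one_le_rpow_of_pos_of_le_one_of_nonpos h0 h1 (sub_nonpos.2 ht)
      linarith
    rw [h, nonpos_iff_eq_zero, mul_eq_zero] at hle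
    rcases hle with hle | hle
    · norm_num at hle
    · exact discArea_ne_zero hle
  · intro ht
    have hlim : Tendsto (fun ρ : ℝ => ENNReal.ofReal (27 * ρ ^ (codim - t)) * discArea)
        (𝓝[>] 0) (𝓝 0) := by
      have h1 : Tendsto (fun ρ : ℝ => 27 * ρ ^ (codim - t)) (𝓝[>] 0) (𝓝 0) := by
        have h2 := ((Real.continuousAt_rpow_const 0 (codim - t)
          (Or.inr (sub_nonneg.2 ht.le))).tendsto.const_mul 27).mono_left
          (nhdsWithin_le_nhds (s := Ioi 0))
        rwa [Real.zero_rpow (sub_pos.2 ht).ne', mul_zero] at h2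
      have h3 := ENNReal.Tendsto.mul_const (b := discArea) (ENNReal.tendsto_ofReal h1)
        (Or.inr discArea_ne_top)
      rwa [ENNReal.ofReal_zero, zero_mul] at h3
    have hz : Tendsto (tubeRatio t) (𝓝[>] 0) (𝓝 0) := by
      refine tendsto_of_tendsto_of_tendsto_of_le_of_le' tendsto_const_nhds hlim
        (Eventually.of_forall fun _ => zero_le) ?_
      filter_upwards [eventually_small] with ρ ⟨h0, h1⟩ using tubeRatio_le h0 h1
    exact hz.liminf_eq

lemma limsup_tubeRatio_eq_top_iff {t : ℝ} :
    limsup (tubeRatio t) (𝓝[>] 0) = ⊤ ↔ codim < t := by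
  constructor
  · intro h
    by_contra! ht
    have hle : limsup (tubeRatio t) (𝓝[>] 0) ≤ ENNReal.ofReal 27 * discArea := by
      refine limsup_le_of_le (by isBoundedDefault) ?_
      filter_upwards [eventually_small] with ρ ⟨h0, h1⟩
      refine (tubeRatio_le h0 h1).trans ?_
      gcongr
      have := Real.rpow_le_one h0.le h1 (sub_nonneg.2 ht)
      linarith
    rw [h, top_le_iff] at hle
    exact ENNReal.mul_ne_top ENNReal.ofReal_ne_top discArea_ne_top hle
  · intro ht
    have hlim : Tendsto (fun ρ : ℝ => ENNReal.ofReal (1 / 2700 * ρ ^ (codim - t)) * discArea)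
        (𝓝[>] 0) (𝓝 ⊤) := by
      have h1 : Tendsto (fun ρ : ℝ => 1 / 2700 * ρ ^ (codim - t)) (𝓝[>] 0) atTop :=
        (tendsto_rpow_neg_nhdsGT_zero (sub_neg.2 ht)).const_mul_atTop (by norm_num)
      have h3 := ENNReal.Tendsto.mul_const (b := discArea)
        (ENNReal.tendsto_ofReal_atTop.comp h1) (Or.inl ENNReal.top_ne_zero)
      rwa [ENNReal.top_mul discArea_ne_zero] at h3
    have hz : Tendsto (tubeRatio t) (𝓝[>] 0) (𝓝 ⊤) := by
      refine tendsto_of_tendsto_of_tendsto_of_le_of_le' hlim tendsto_const_nhds ?_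
        (Eventually.of_forall fun _ => le_top)
      filter_upwards [eventually_small] with ρ ⟨h0, h1⟩ using le_tubeRatio h0 h1
    exact hz.limsup_eq

lemma lowerMinkowskiDim_frontier :
    lowerMinkowskiDim (frontier snowflake) univ = 2 - codim := by
  have h : {r : ℝ | r ∈ Icc (0 : ℝ) ((2 : ℕ) : ℝ) ∧
      lowerMinkowskiContent (((2 : ℕ) : ℝ) - r) (frontier snowflake) univ = 0} = Ico 0 codim := by
    ext r
    have h1 : lowerMinkowskiContent (((2 : ℕ) : ℝ) - r) (frontier snowflake) univ =
        liminf (tubeRatio r) (𝓝[>] 0) := by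
      simp only [lowerMinkowskiContent, sub_sub_cancel]
      rfl
    rw [mem_ofPred_eq, h1, liminf_tubeRatio_eq_zero_iff]
    constructor
    · rintro ⟨h2, h3⟩
      exact ⟨h2.1, h3⟩
    · rintro ⟨h2, h3⟩
      refine ⟨⟨h2, ?_⟩, h3⟩
      push_cast
      linarith [codim_lt_one]
  rw [lowerMinkowskiDim, h, csSup_Ico codim_pos]
  norm_num

lemma upperMinkowskiDim_frontier :
    upperMinkowskiDim (frontier snowflake) univ = 2 - codim := by
  have h : {r : ℝ | r ∈ Icc (0 : ℝ) ((2 : ℕ) : ℝ) ∧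
      upperMinkowskiContent r (frontier snowflake) univ = ⊤} = Ico 0 (2 - codim) := by
    ext r
    have h1 : upperMinkowskiContent r (frontier snowflake) univ =
        limsup (tubeRatio (((2 : ℕ) : ℝ) - r)) (𝓝[>] 0) := rfl
    rw [mem_ofPred_eq, h1, limsup_tubeRatio_eq_top_iff]
    push_cast
    constructor
    · rintro ⟨h2, h3⟩
      exact ⟨h2.1, by linarith⟩
    · rintro ⟨h2, h3⟩
      exact ⟨⟨h2, by linarith [codim_pos]⟩, by linarith⟩
  rw [upperMinkowskiDim, h, csSup_Ico (by linarith [codim_lt_one])]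

end KochSnowflake

theorem theorem1 :
    (∀ s : ℝ, s ∈ Set.Ioo (0 : ℝ) (2 - Real.log 4 / Real.log 3) →
      KochSnowflake.fracPerimeter s KochSnowflake.snowflake < ⊤) ∧
    (∀ s : ℝ, s ∈ Set.Ico (2 - Real.log 4 / Real.log 3) (1 : ℝ) →
      KochSnowflake.fracPerimeter s KochSnowflake.snowflake = ⊤) ∧
    KochSnowflake.measureBoundary KochSnowflake.snowflake = frontier KochSnowflake.snowflake ∧
    KochSnowflake.fracDim KochSnowflake.snowflake Set.univ = Real.log 4 / Real.log 3 ∧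
    KochSnowflake.lowerMinkowskiDim (frontier KochSnowflake.snowflake) Set.univ =
      Real.log 4 / Real.log 3 ∧
    KochSnowflake.upperMinkowskiDim (frontier KochSnowflake.snowflake) Set.univ =
      Real.log 4 / Real.log 3 := by
  have h : 2 - KochSnowflake.codim = Real.log 4 / Real.log 3 := sub_sub_cancel _ _
  rw [← h]
  refine ⟨fun s hs => ?_, fun s hs => ?_, KochSnowflake.measureBoundary_snowflake,
    KochSnowflake.fracDim_snowflake, KochSnowflake.lowerMinkowskiDim_frontier,
    KochSnowflake.upperMinkowskiDim_frontier⟩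
  · rw [sub_sub_cancel] at hs
    exact KochSnowflake.fracPerimeter_lt_top hs.1 hs.2
  · rw [sub_sub_cancel] at hs
    exact KochSnowflake.fracPerimeter_eq_top hs.1
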